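/- Let $(M^n,g)$ be a Hermitian manifold (a complex manifold with complex structure $J$ and a smooth $J$-invariant Riemannian metric $g$; no compactness is assumed), with Riemannian (Levi-Civita) connection $\nabla$, Chern connection $\nabla^c$ and Strominger (Bismut) connection $\nabla^s$. For real numbers $r,s$ let $$D^r=\tfrac{1+r}{2}\nabla^c+\tfrac{1-r}{2}\nabla^s,\qquad D^r_s=(1-s)D^r+s\nabla .$$ The connection $D=D^r_s$ is called Kähler-like if its curvature tensor $R^D(x,y,z,w)=g(R^D(x,y)z,w)$ satisfies $$R^D(x,y,z,w)+R^D(y,z,x,w)+R^D(z,x,y,w)=0,$$ $$R^D(Jx,Jy,z,w)=R^D(x,y,z,w)=R^D(x,y,Jz,Jw)$$ for all real tangent vectors $x,y,z,w$ at every point of $M$. Let $$\Omega=\mathbb R^2\setminus\{(r,1)\mid r\neq 0\},\qquad \Omega'=\Omega\setminus\Big(\{s=0\}\cup\{(0,1),(0,-1),(-1,2),(\tfrac13,-2)\}\Big).$$ The line $s=0$ consists of the Gauduchon connections $D^r$, and the four excluded points give the Riemannian connection $\nabla=D^0_1$, the anti-Riemannian connection $\nabla'=D^0_{-1}$, $\nabla^+=D^{-1}_2$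 and $\nabla^-=D^{1/3}_{-2}$. If $D^r_s$ is Kähler-like for some $(r,s)\in\Omega'$, then $g$ is Kähler, that is, the fundamental form $\omega=g(J\cdot,\cdot)$ is closed. -/

import Mathlib

open scoped Manifold ContDiff Topology

noncomputable section

namespace HermitianGeometry

/-! ## Calculus of a Hermitian metric in a holomorphic chart

Here `E` is a finite-dimensional complex vector space, and `G z` is the value at `z` of the
(real) inner product on tangent vectors, on some open subset of `E`.  The complex structure of the
chart is the constant endomorphism `mulI E`, multiplication by the imaginary unit.
A connection on the (real) tangent bundle over the chart is given by its Christoffel symbol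
`Γ : E → E → E → E`, that is, `(D_u W)(z) = dW_z(u) + Γ z u (W z)` for a vector field `W`. -/

section Local

variable {E : Type*} [NormedAddCommGroup E] [NormedSpace ℂ E]

variable (E) in
/-- The constant complex structure `J` of a complex vector space, as a real-linear map. -/
def mulI : E →L[ℝ] E :=
  (Complex.I • ContinuousLinearMap.id ℂ E).restrictScalars ℝ

theorem mulI_apply (v : E) : mulI E v = Complex.I • v := rfl

/-- The vector that represents the real functional `α` with respect to the inner product `B`. -/
def raiseIndex (B : E →L[ℝ] E →L[ℝ] ℝ) (α : E →L[ℝ] ℝ) : E :=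
  B.inverse α

/-- The fundamental two-form `ω(v, w) = g(Jv, w)` in the chart. -/
def omegaLocal (G : E → E →L[ℝ] E →L[ℝ] ℝ) (z : E) : E →L[ℝ] E →L[ℝ] ℝ :=
  (G z).comp (mulI E)

/-- The exterior derivative of the fundamental two-form in the chart,
`dω(u, v, w) = D_u ω (v, w) - D_v ω (u, w) + D_w ω (u, v)`, as a functional of `w`. -/
def dOmegaLocal (G : E → E →L[ℝ] E →L[ℝ] ℝ) (z u v : E) : E →L[ℝ] ℝ :=
  fderiv ℝ (omegaLocal G) z u v - fderiv ℝ (omegaLocal G) z v u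
    + ((fderiv ℝ (omegaLocal G) z).flip u).flip v

/-- Christoffel symbol of the Riemannian (Levi-Civita) connection:
`2 g(Γ(u, v), w) = D_u g (v, w) + D_v g (u, w) - D_w g (u, v)`. -/
def leviCivitaSymbol (G : E → E →L[ℝ] E →L[ℝ] ℝ) (z u v : E) : E :=
  raiseIndex (G z) ((1 / 2 : ℝ) •
    (fderiv ℝ G z u v + fderiv ℝ G z v u - ((fderiv ℝ G z).flip u).flip v))

/-- Christoffel symbol of the Chern connection:
`2 g(Γ(u, v), w) = D_u g (v, w) + D_{Ju} g (v, Jw)`. For the Hermitian form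
`h(v, w) = g(v, w) + i g(v, Jw)`, which is complex-linear in `v`, this is the real part of
`h(Γ(u, v), w) = (∂h)(u)(v, w)`, where `∂ = (D_u - i D_{Ju}) / 2`. -/
def chernSymbol (G : E → E →L[ℝ] E →L[ℝ] ℝ) (z u v : E) : E :=
  raiseIndex (G z) ((1 / 2 : ℝ) •
    (fderiv ℝ G z u v + (fderiv ℝ G z (mulI E u) v).comp (mulI E)))

/-- Christoffel symbol of the Strominger (Bismut) connection:
`g(Γ(u, v), w) = g(Γ_LC(u, v), w) + (1/2) dω(Ju, Jv, Jw)`. -/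
def stromingerSymbol (G : E → E →L[ℝ] E →L[ℝ] ℝ) (z u v : E) : E :=
  leviCivitaSymbol G z u v + raiseIndex (G z) ((1 / 2 : ℝ) •
    (dOmegaLocal G z (mulI E u) (mulI E v)).comp (mulI E))

/-- Christoffel symbol of the Gauduchon connection `D^r = (1+r)/2 ∇^c + (1-r)/2 ∇^s`. -/
def gauduchonSymbol (G : E → E →L[ℝ] E →L[ℝ] ℝ) (r : ℝ) (z u v : E) : E :=
  ((1 + r) / 2) • chernSymbol G z u v + ((1 - r) / 2) • stromingerSymbol G z u v

/-- Christoffel symbol of the canonical `(r,s)`-connection `D^r_s = (1-s) D^r + s ∇`. -/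
def canonicalSymbol (G : E → E →L[ℝ] E →L[ℝ] ℝ) (r s : ℝ) (z u v : E) : E :=
  (1 - s) • gauduchonSymbol G r z u v + s • leviCivitaSymbol G z u v

/-- The curvature `R(u, v) w = D_u D_v w - D_v D_u w` (for constant vector fields `u`, `v`, `w`
in the chart, so that `[u, v] = 0`) of the connection with Christoffel symbol `Γ`. -/
def curvatureLocal (Γ : E → E → E → E) (z u v w : E) : E :=
  fderiv ℝ (fun y => Γ y v w) z u - fderiv ℝ (fun y => Γ y u w) z v
    + Γ z u (Γ z v w) - Γ z v (Γ z u w)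

/-- The curvature tensor `R(x, y, z, w) = g(R(x, y) z, w)` at the point `p` of the chart. -/
def curvatureTensor (G : E → E →L[ℝ] E →L[ℝ] ℝ) (Γ : E → E → E → E) (p x y z w : E) : ℝ :=
  G p (curvatureLocal Γ p x y z) w

/-- The Kähler-like symmetries, for real tangent vectors, of a curvature tensor at one point:
the first Bianchi identity (without torsion terms) and the type condition. -/
def KahlerLikeTensor (R : E → E → E → E → ℝ) : Prop :=
  (∀ x y z w, R x y z w + R y z x w + R z x y w = 0) ∧
  (∀ x y z w, R (mulI E x) (mulI E y) z w = R x y z w) ∧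
  (∀ x y z w, R x y z w = R x y (mulI E z) (mulI E w))

/-! ### The symbols above are those of the connections they are named after -/

section Checks

theorem raiseIndex_spec [FiniteDimensional ℂ E] {B : E →L[ℝ] E →L[ℝ] ℝ} (hB : ∀ v, v ≠ 0 → 0 < B v v)
    (α : E →L[ℝ] ℝ) (w : E) : B (raiseIndex B α) w = α w := by
  have : FiniteDimensional ℝ E := FiniteDimensional.complexToReal E
  have : FiniteDimensional ℝ (E →L[ℝ] ℝ) := inferInstance
  have hinj : Function.Injective B.toLinearMap := by
    rw [injective_iff_map_eq_zero]
    intro v hv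
    by_contra hne
    have h := hB v hne
    have h2 : B v = 0 := hv
    rw [h2] at h
    simp at h
  have hfr : Module.finrank ℝ E = Module.finrank ℝ (E →L[ℝ] ℝ) := by
    rw [← (LinearMap.toContinuousLinearMap (𝕜 := ℝ) (E := E) (F' := ℝ)).finrank_eq]
    exact (Subspace.dual_finrank_eq (K := ℝ) (V := E)).symm
  let e : E ≃L[ℝ] (E →L[ℝ] ℝ) :=
    (LinearEquiv.ofInjectiveOfFinrankEq B.toLinearMap hinj hfr).toContinuousLinearEquiv
  have he : (e : E →L[ℝ] (E →L[ℝ] ℝ)) = B := by ext v w; rfl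
  have h1 : raiseIndex B α = e.symm α := by
    rw [raiseIndex, ← he, ContinuousLinearMap.inverse_equiv]; rfl
  have h2 : e (e.symm α) = α := e.apply_symm_apply α
  rw [h1]
  calc B (e.symm α) w = e (e.symm α) w := by rw [← he]; rfl
    _ = α w := by rw [h2]

/-- `G` is, near `z`, a Hermitian metric that is differentiable at `z`. -/
structure IsHermitianNear (G : E → E →L[ℝ] E →L[ℝ] ℝ) (z : E) : Prop where
  diff : DifferentiableAt ℝ G z
  pos : ∀ v, v ≠ 0 → 0 < G z v v
  symm : ∀ᶠ y in 𝓝 z, ∀ v w, G y v w = G y w v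
  inv : ∀ᶠ y in 𝓝 z, ∀ v w, G y (mulI E v) (mulI E w) = G y v w

variable {G : E → E →L[ℝ] E →L[ℝ] ℝ} {z : E}

theorem mulI_mulI (v : E) : mulI E (mulI E v) = -v := by
  simp [mulI_apply, smul_smul]

theorem fderiv_apply₂ (h : DifferentiableAt ℝ G z) (u v w : E) :
    fderiv ℝ (fun y => G y v w) z u = fderiv ℝ G z u v w := by
  have h1 := ((h.hasFDerivAt.clm_apply (hasFDerivAt_const v z)).clm_apply
    (hasFDerivAt_const w z)).fderiv
  rw [h1]; simp

theorem IsHermitianNear.d_symm (h : IsHermitianNear G z) (u v w : E) :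
    fderiv ℝ G z u v w = fderiv ℝ G z u w v := by
  rw [← fderiv_apply₂ h.diff, ← fderiv_apply₂ h.diff]
  congr 1
  exact Filter.EventuallyEq.fderiv_eq (h.symm.mono fun y hy => hy v w)

theorem IsHermitianNear.d_inv (h : IsHermitianNear G z) (u v w : E) :
    fderiv ℝ G z u (mulI E v) (mulI E w) = fderiv ℝ G z u v w := by
  rw [← fderiv_apply₂ h.diff, ← fderiv_apply₂ h.diff]
  congr 1
  exact Filter.EventuallyEq.fderiv_eq (h.inv.mono fun y hy => hy v w)

theorem IsHermitianNear.d_skew (h : IsHermitianNear G z) (u v w : E) :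
    fderiv ℝ G z u (mulI E v) w = -fderiv ℝ G z u v (mulI E w) := by
  rw [← h.d_inv u v (mulI E w), mulI_mulI]; simp

theorem IsHermitianNear.skew (h : IsHermitianNear G z) (v w : E) :
    G z (mulI E v) w = -G z v (mulI E w) := by
  rw [← h.inv.self_of_nhds v (mulI E w), mulI_mulI]; simp

theorem IsHermitianNear.d_omega (h : IsHermitianNear G z) (u v w : E) :
    fderiv ℝ (omegaLocal G) z u v w = fderiv ℝ G z u (mulI E v) w := by
  have h1 : HasFDerivAt (omegaLocal G) _ z :=
    h.diff.hasFDerivAt.clm_comp (hasFDerivAt_const (mulI E) z)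
  rw [h1.fderiv]; simp

theorem IsHermitianNear.ext (h : IsHermitianNear G z) {a b : E} (hab : ∀ w, G z a w = G z b w) :
    a = b := by
  by_contra hne
  have h1 := h.pos (a - b) (sub_ne_zero.2 hne)
  have h2 := hab (a - b)
  simp only [map_sub, sub_apply] at h1 h2
  linarith

theorem IsHermitianNear.g_leviCivita [FiniteDimensional ℂ E] (h : IsHermitianNear G z) (u v w : E) :
    G z (leviCivitaSymbol G z u v) w =
      (1 / 2) * (fderiv ℝ G z u v w + fderiv ℝ G z v u w - fderiv ℝ G z w u v) := by
  rw [leviCivitaSymbol, raiseIndex_spec h.pos]; simp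

theorem IsHermitianNear.g_chern [FiniteDimensional ℂ E] (h : IsHermitianNear G z) (u v w : E) :
    G z (chernSymbol G z u v) w =
      (1 / 2) * (fderiv ℝ G z u v w + fderiv ℝ G z (mulI E u) v (mulI E w)) := by
  rw [chernSymbol, raiseIndex_spec h.pos]; simp; ring

theorem IsHermitianNear.g_strominger [FiniteDimensional ℂ E] (h : IsHermitianNear G z) (u v w : E) :
    G z (stromingerSymbol G z u v) w = G z (leviCivitaSymbol G z u v) w
      + (1 / 2) * dOmegaLocal G z (mulI E u) (mulI E v) (mulI E w) := by
  rw [stromingerSymbol, map_add, add_apply, raiseIndex_spec h.pos]; simp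

theorem IsHermitianNear.dOmega_apply (h : IsHermitianNear G z) (u v w : E) :
    dOmegaLocal G z u v w = fderiv ℝ G z u (mulI E v) w - fderiv ℝ G z v (mulI E u) w
      + fderiv ℝ G z w (mulI E u) v := by
  simp [dOmegaLocal, h.d_omega]

/-- The Levi-Civita connection is metric and torsion-free. -/
theorem leviCivita_spec [FiniteDimensional ℂ E] (h : IsHermitianNear G z) :
    (∀ u v w, G z (leviCivitaSymbol G z u v) w + G z v (leviCivitaSymbol G z u w)
      = fderiv ℝ G z u v w) ∧
    (∀ u v, leviCivitaSymbol G z u v = leviCivitaSymbol G z v u) := by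
  refine ⟨fun u v w => ?_, fun u v => h.ext fun w => ?_⟩
  · rw [h.symm.self_of_nhds v, h.g_leviCivita, h.g_leviCivita]
    linarith [h.d_symm u v w, h.d_symm v u w, h.d_symm w u v]
  · rw [h.g_leviCivita, h.g_leviCivita]
    linarith [h.d_symm w u v]

/-- The Chern connection is metric, parallelizes `J`, and its torsion has no `(1,1)` part. -/
theorem chern_spec [FiniteDimensional ℂ E] (h : IsHermitianNear G z) :
    (∀ u v w, G z (chernSymbol G z u v) w + G z v (chernSymbol G z u w)
      = fderiv ℝ G z u v w) ∧
    (∀ u v, chernSymbol G z u (mulI E v) = mulI E (chernSymbol G z u v)) ∧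
    (∀ u v, chernSymbol G z (mulI E u) (mulI E v) - chernSymbol G z (mulI E v) (mulI E u)
      = -(chernSymbol G z u v - chernSymbol G z v u)) := by
  refine ⟨fun u v w => ?_, fun u v => h.ext fun w => ?_, fun u v => h.ext fun w => ?_⟩
  · rw [h.symm.self_of_nhds v, h.g_chern, h.g_chern]
    linarith [h.d_symm u v w, h.d_skew (mulI E u) v w, h.d_symm (mulI E u) (mulI E v) w]
  · rw [h.skew, h.g_chern, h.g_chern, h.d_skew, h.d_inv, mulI_mulI]
    simp; ring
  · simp only [map_sub, map_neg, sub_apply, neg_apply,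
      h.g_chern, h.d_inv, h.d_skew, mulI_mulI]
    linarith

/-- The Strominger connection is metric, parallelizes `J`, and its torsion is totally skew. -/
theorem strominger_spec [FiniteDimensional ℂ E] (h : IsHermitianNear G z) :
    (∀ u v w, G z (stromingerSymbol G z u v) w + G z v (stromingerSymbol G z u w)
      = fderiv ℝ G z u v w) ∧
    (∀ u v, stromingerSymbol G z u (mulI E v) = mulI E (stromingerSymbol G z u v)) ∧
    (∀ u v w, G z (stromingerSymbol G z u v - stromingerSymbol G z v u) w
      = -G z (stromingerSymbol G z u w - stromingerSymbol G z w u) v) := by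
  refine ⟨fun u v w => ?_, fun u v => h.ext fun w => ?_, fun u v w => ?_⟩
  · rw [h.symm.self_of_nhds v]
    simp only [h.g_strominger, h.g_leviCivita, h.dOmega_apply, mulI_mulI,
      map_neg, neg_apply]
    linarith [h.d_symm u v w, h.d_symm v u w, h.d_symm w u v, h.d_symm (mulI E u) v (mulI E w),
      h.d_skew (mulI E u) w v, h.d_skew (mulI E v) u w, h.d_symm (mulI E v) (mulI E u) w,
      h.d_skew (mulI E w) u v, h.d_symm (mulI E w) (mulI E u) v]
  · rw [h.skew]
    simp only [h.g_strominger, h.g_leviCivita, h.dOmega_apply, h.d_inv, h.d_skew, mulI_mulI,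
      map_neg, neg_apply]
    linarith [h.d_symm u v w, h.d_symm v u w, h.d_symm w u v, h.d_symm (mulI E u) v (mulI E w),
      h.d_skew (mulI E u) w v, h.d_skew (mulI E v) u w, h.d_symm (mulI E v) (mulI E u) w,
      h.d_skew (mulI E w) u v, h.d_symm (mulI E w) (mulI E u) v]
  · simp only [map_sub, sub_apply, h.g_strominger, h.g_leviCivita,
      h.dOmega_apply, mulI_mulI, map_neg, neg_apply]
    linarith [h.d_symm u v w, h.d_symm v u w, h.d_symm w u v, h.d_symm (mulI E u) v (mulI E w),
      h.d_skew (mulI E u) w v, h.d_skew (mulI E v) u w, h.d_symm (mulI E v) (mulI E u) w,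
      h.d_skew (mulI E w) u v, h.d_symm (mulI E w) (mulI E u) v]

end Checks

end Local

/-! ## Hermitian manifolds -/

section Global

variable (E : Type*) [NormedAddCommGroup E] [NormedSpace ℂ E]
variable (M : Type*) [TopologicalSpace M] [ChartedSpace E M]

/-- A complex manifold is a real (analytic, hence smooth) manifold. -/
instance isManifold_real [IsManifold 𝓘(ℂ, E) ω M] : IsManifold 𝓘(ℝ, E) ω M := by
  apply isManifold_of_contDiffOn
  intro e e' he he'
  have h := (contDiffGroupoid ω 𝓘(ℂ, E)).compatible he he'
  rw [contDiffGroupoid, mem_groupoid_of_pregroupoid] at h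
  exact ContDiffOn.restrict_scalars ℝ h.1

variable {M} in
/-- The complex structure on the real tangent space at `x`. The tangent space is identified with
`E` through the preferred chart at `x`; as all charts are holomorphic, any other chart gives the
same endomorphism. -/
def complexStructure (x : M) : TangentSpace 𝓘(ℝ, E) x →L[ℝ] TangentSpace 𝓘(ℝ, E) x :=
  (mulI E : E →L[ℝ] E)

/-- A Hermitian metric on a complex manifold: a smooth Riemannian metric for which the complex
structure is orthogonal. -/
structure HermitianMetric [IsManifold 𝓘(ℂ, E) ω M] extends
    Bundle.ContMDiffRiemannianMetric 𝓘(ℝ, E) ∞ E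
      (fun x : M => TangentSpace 𝓘(ℝ, E) x) where
  inner_J (x : M) (v w : TangentSpace 𝓘(ℝ, E) x) :
    inner x (complexStructure E x v) (complexStructure E x w) = inner x v w

variable {E M}

namespace HermitianMetric

variable [IsManifold 𝓘(ℂ, E) ω M] (g : HermitianMetric E M)

/-- The expression of the metric in the chart `e`: for `z` in the target of the chart,
`v` and `w` are seen as tangent vectors at the point `e.symm z` of the manifold. -/
def inChart (e : OpenPartialHomeomorph M E) (z : E) : E →L[ℝ] E →L[ℝ] ℝ :=
  ContinuousLinearMap.bilinearComp (E := E) (F := E) (E' := E) (F' := E) (G := ℝ)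
    (g.inner (e.symm z)) (mfderiv 𝓘(ℝ, E) 𝓘(ℝ, E) e.symm z) (mfderiv 𝓘(ℝ, E) 𝓘(ℝ, E) e.symm z)

theorem inChart_apply (e : OpenPartialHomeomorph M E) (z v w : E) :
    g.inChart e z v w = g.inner (e.symm z) (mfderiv 𝓘(ℝ, E) 𝓘(ℝ, E) e.symm z v)
      (mfderiv 𝓘(ℝ, E) 𝓘(ℝ, E) e.symm z w) := rfl

/-- The canonical connection `D^r_s` of the metric is Kähler-like: at every point, its curvature
tensor, expressed in any chart, has the Kähler-like symmetries. -/
def IsKahlerLike (r s : ℝ) : Prop :=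
  ∀ e ∈ atlas E M, ∀ z ∈ e.target,
    KahlerLikeTensor (curvatureTensor (g.inChart e) (canonicalSymbol (g.inChart e) r s) z)

/-- The metric is Kähler: its fundamental two-form `ω = g(J·, ·)` is closed. -/
def IsKahler : Prop :=
  ∀ e ∈ atlas E M, ∀ z ∈ e.target, ∀ u v w : E, dOmegaLocal (g.inChart e) z u v w = 0

end HermitianMetric

end Global

/-- The parameter space `Ω` of the plane of canonical connections: the plane of all `(r,s)` minus
the points `(r,1)` with `r ≠ 0` (as `D^r_1` is the Riemannian connection for every `r`). -/
def Omega : Set (ℝ × ℝ) :=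
  {p | ¬ (p.1 ≠ 0 ∧ p.2 = 1)}

/-- The set `Ω'`: the complement in `Ω` of the Gauduchon line `s = 0` and of the four points of
the Riemannian, the anti-Riemannian, and the `∇⁺` and `∇⁻` connections. -/
def OmegaPrime : Set (ℝ × ℝ) :=
  Omega \ ({p | p.2 = 0} ∪ {(0, 1), (0, -1), (-1, 2), (1 / 3, -2)})

end HermitianGeometry

end

set_option linter.unusedSimpArgs false

open scoped Manifold ContDiff Topology

namespace HermitianGeometry

/-! Relative to the Chern connection, `D^r_s` is `∇^c_u v + t (S_u v - T_u v) + s S_v u`, where `T`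
is half the Chern torsion, `S_u` is the adjoint of `T_u`, and `t = (1-s)(1-r) + s = 1 - r(1-s)`.
Since `T` is complex bilinear and `S_u v` is antilinear in `u`, the last term alone fails to commute
with `J`. Hence, for `s ≠ 0`, commutation of the curvature with `J` is an extra equation on `T` and
`∇^c T`. Splitting the Kähler-like identities by type constrains both halves of `∇^c T` (`Nhol_eq`,
`Nanti_eq`) and, for `t ≠ 0, 1`, gives `T(T(x,y),v) = 0`. It remains to deduce `T = 0`, which makes
`ω` closed (`dOmega_eq_zero`).

Three cases arise, all closed by positivity of `g`. If `t = 1`, then `s² ≠ 1` and `Nanti_eq` becomes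
a purely algebraic symmetry of `S` (`T_eq_zero_of_one`). If `t ≠ 0, 1`, the identity `T(T(x,y),v) =
0` reduces everything to vectors orthogonal to the image of `T` (`T_eq_zero_of_ne`). If `t = 0`,
then `s² ≠ 4` and `T` is a Lie bracket; it is unimodular (`trace_T`), and the trace of `Nanti_eq` is
a sum of squares (`T_eq_zero_of_zero`). The excluded points of `Ω` are exactly where `t = 1, s² = 1`
or `t = 0, s² = 4`. -/

/-- The first-order data of a Hermitian metric at a point: the metric, (half of) the torsion `T` of
the Chern connection, its partial adjoint `S`, their covariant derivatives `N` and `M`, and the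
curvature `R` of the Chern connection. -/
structure TorsionJet (E : Type*) [AddCommGroup E] [Module ℝ E] where
  J : E →ₗ[ℝ] E
  g : E →ₗ[ℝ] E →ₗ[ℝ] ℝ
  T : E →ₗ[ℝ] E →ₗ[ℝ] E
  S : E →ₗ[ℝ] E →ₗ[ℝ] E
  N : E →ₗ[ℝ] E →ₗ[ℝ] E →ₗ[ℝ] E
  M : E →ₗ[ℝ] E →ₗ[ℝ] E →ₗ[ℝ] E
  R : E →ₗ[ℝ] E →ₗ[ℝ] E →ₗ[ℝ] E
  J_J : ∀ v, J (J v) = -v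
  g_symm : ∀ v w, g v w = g w v
  g_pos : ∀ v, v ≠ 0 → 0 < g v v
  g_J : ∀ v w, g (J v) (J w) = g v w
  T_swap : ∀ u v, T u v = -T v u
  T_J : ∀ u v, T (J u) v = J (T u v)
  S_spec : ∀ u v w, g (S u v) w = g v (T u w)
  N_swap : ∀ x u v, N x u v = -N x v u
  N_J : ∀ x u v, N x (J u) v = J (N x u v)
  M_spec : ∀ x u v w, g (M x u v) w = g v (N x u w)
  R_swap : ∀ x y v, R x y v = -R y x v
  R_J_J : ∀ x y v, R (J x) (J y) v = R x y v
  R_comp_J : ∀ x y v, R x y (J v) = J (R x y v)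
  -- The first Bianchi identity for a connection with torsion `2 T`, whence the factors 2 and 4.
  bianchi : ∀ x y z, R x y z + R y z x + R z x y =
    (2 : ℝ) • (N x y z + N y z x + N z x y)
      + (4 : ℝ) • (T (T x y) z + T (T y z) x + T (T z x) y)

/-! ### Type decomposition of the Kähler-like identities at a point -/

namespace TorsionJet

variable {E : Type*} [AddCommGroup E] [Module ℝ E] (τ : TorsionJet E)

theorem ext_g {a b : E} (h : ∀ w, τ.g a w = τ.g b w) : a = b := by
  by_contra hne
  have h1 := τ.g_pos (a - b) (sub_ne_zero.2 hne)
  have h2 := h (a - b)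
  simp only [map_sub, LinearMap.sub_apply] at h1 h2
  linarith

theorem eq_zero_of_g {a : E} (h : τ.g a a = 0) : a = 0 := by
  by_contra hne
  exact (τ.g_pos a hne).ne' h

theorem g_J_left (v w : E) : τ.g (τ.J v) w = -τ.g v (τ.J w) := by
  rw [← τ.g_J v (τ.J w), τ.J_J]; simp

theorem T_J_right (u v : E) : τ.T u (τ.J v) = τ.J (τ.T u v) := by
  rw [τ.T_swap, τ.T_J, τ.T_swap v u]; simp

theorem N_J_right (x u v : E) : τ.N x u (τ.J v) = τ.J (τ.N x u v) := by
  rw [τ.N_swap, τ.N_J, τ.N_swap x v u]; simp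

theorem S_J (u v : E) : τ.S (τ.J u) v = -τ.J (τ.S u v) := by
  refine τ.ext_g fun w => ?_
  simp only [τ.S_spec, map_neg, LinearMap.neg_apply, τ.g_J_left, τ.T_J, τ.T_J_right, neg_neg]

theorem S_J_right (u v : E) : τ.S u (τ.J v) = τ.J (τ.S u v) := by
  refine τ.ext_g fun w => ?_
  simp only [τ.S_spec, τ.g_J_left, τ.T_J_right]

theorem M_J (x u v : E) : τ.M x (τ.J u) v = -τ.J (τ.M x u v) := by
  refine τ.ext_g fun w => ?_
  simp only [τ.M_spec, map_neg, LinearMap.neg_apply, τ.g_J_left, τ.N_J, τ.N_J_right, neg_neg]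

theorem M_J_right (x u v : E) : τ.M x u (τ.J v) = τ.J (τ.M x u v) := by
  refine τ.ext_g fun w => ?_
  simp only [τ.M_spec, τ.g_J_left, τ.N_J_right]

theorem R_J (x y v : E) : τ.R x (τ.J y) v = -τ.R (τ.J x) y v := by
  rw [← τ.R_J_J x (τ.J y), τ.J_J]; simp

/-- The difference of the connection with parameters `t`, `s` and the Chern connection. -/
noncomputable def diff (t s : ℝ) (u v : E) : E :=
  t • (τ.S u v - τ.T u v) + s • τ.S v u

/-- The covariant derivative of `diff` with respect to the Chern connection. -/
noncomputable def diffDeriv (t s : ℝ) (x u v : E) : E :=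
  t • (τ.M x u v - τ.N x u v) + s • τ.M x v u

/-- The curvature of the connection that differs by `diff` from the Chern connection. -/
noncomputable def curv (t s : ℝ) (x y v : E) : E :=
  τ.R x y v + τ.diffDeriv t s x y v - τ.diffDeriv t s y x v + (2 : ℝ) • τ.diff t s (τ.T x y) v
    + τ.diff t s x (τ.diff t s y v) - τ.diff t s y (τ.diff t s x v)

/-- The part of type `(1, 0)` in `x` of the covariant derivative of the torsion. -/
noncomputable def Nhol (x u v : E) : E := (1 / 2 : ℝ) • (τ.N x u v - τ.J (τ.N (τ.J x) u v))

/-- The part of type `(0, 1)` in `x` of the covariant derivative of the torsion. -/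
noncomputable def Nanti (x u v : E) : E := (1 / 2 : ℝ) • (τ.N x u v + τ.J (τ.N (τ.J x) u v))

/-- The part of type `(1, 0)` in `x` of the covariant derivative of `S`. -/
noncomputable def Mhol (x u v : E) : E := (1 / 2 : ℝ) • (τ.M x u v - τ.J (τ.M (τ.J x) u v))

/-- The part of type `(0, 1)` in `x` of the covariant derivative of `S`. -/
noncomputable def Manti (x u v : E) : E := (1 / 2 : ℝ) • (τ.M x u v + τ.J (τ.M (τ.J x) u v))

/-- `J` is skew for `g`, so passing to the adjoint exchanges the types (1,0) and (0,1) in the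
direction of differentiation. -/
theorem g_Mhol (x u v w : E) : τ.g (τ.Mhol x u v) w = τ.g v (τ.Nanti x u w) := by
  simp only [Mhol, Nanti, map_smul, LinearMap.smul_apply, map_sub, map_add, LinearMap.sub_apply,
    τ.g_J_left, τ.M_spec, τ.N_J_right, sub_neg_eq_add]

theorem g_Manti (x u v w : E) : τ.g (τ.Manti x u v) w = τ.g v (τ.Nhol x u w) := by
  simp only [Manti, Nhol, map_smul, LinearMap.smul_apply, map_add, map_neg, LinearMap.add_apply,
    τ.g_J_left, τ.M_spec, τ.N_J_right, sub_eq_add_neg]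

/-- The Kähler-like symmetries of the curvature. -/
structure KahlerLike (t s : ℝ) : Prop where
  cyclic : ∀ x y z, τ.curv t s x y z + τ.curv t s y z x + τ.curv t s z x y = 0
  type : ∀ x y z, τ.curv t s (τ.J x) (τ.J y) z = τ.curv t s x y z
  comm : ∀ x y z, τ.curv t s x y (τ.J z) = τ.J (τ.curv t s x y z)

variable {τ} {t s : ℝ}

namespace KahlerLike

/-- A curvature commuting with `J` has no part antilinear in `v`. That part comes from an odd number
of factors `s S_v`, so it is `s` times the expression below; the `s²` terms are linear in `v`. -/
theorem antilinear_part (h : τ.KahlerLike t s) (hs : s ≠ 0) (x y v : E) :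
    τ.M x v y - τ.M y v x + (2 : ℝ) • τ.S v (τ.T x y)
      + t • (τ.S x (τ.S v y) - τ.T x (τ.S v y) + τ.S (τ.S y v - τ.T y v) x
        - τ.S y (τ.S v x) + τ.T y (τ.S v x) - τ.S (τ.S x v - τ.T x v) y) = 0 := by
  have h1 := congrArg τ.J (h.comm x y v)
  simp only [curv, diff, diffDeriv, map_add, map_sub, map_neg, map_smul, τ.T_J_right,
    τ.S_J, τ.S_J_right, τ.N_J_right, τ.M_J, τ.M_J_right, τ.R_comp_J, τ.J_J,
    LinearMap.add_apply, LinearMap.sub_apply, LinearMap.neg_apply, LinearMap.smul_apply] at h1 ⊢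
  refine (smul_eq_zero_iff_right hs).1 ?_
  linear_combination (norm := module) (1 / 2 : ℝ) • h1

/-- No term of `antilinear_part` is antilinear in both `x` and `y`, so antisymmetrizing under `(x,
y) ↦ (Jx, Jy)` leaves the complex bilinear terms. -/
theorem antilinear_part_two_zero (h : τ.KahlerLike t s) (hs : s ≠ 0) (x y v : E) :
    τ.Mhol x v y - τ.Mhol y v x + (2 : ℝ) • τ.S v (τ.T x y)
      + t • (τ.S (τ.S y v) x - τ.T x (τ.S v y) + τ.T y (τ.S v x) - τ.S (τ.S x v) y) = 0 := by
  have h1 := h.antilinear_part hs x y v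
  have h2 := h.antilinear_part hs (τ.J x) (τ.J y) v
  simp only [Mhol, map_add, map_sub, map_neg, map_smul, τ.T_J, τ.T_J_right, τ.S_J, τ.S_J_right,
    τ.M_J_right, τ.J_J, LinearMap.add_apply, LinearMap.sub_apply, LinearMap.neg_apply,
    LinearMap.smul_apply] at h1 h2 ⊢
  linear_combination (norm := module) (1 / 2 : ℝ) • h1 - (1 / 2 : ℝ) • h2

theorem Manti_eq (h : τ.KahlerLike t s) (hs : s ≠ 0) (x y v : E) :
    τ.Manti x v y = -t • (τ.S x (τ.S v y) + τ.S (τ.T x v) y) := by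
  have h1 := h.antilinear_part hs x y v
  have h2 := h.antilinear_part hs (τ.J x) (τ.J y) v
  have h3 := congrArg τ.J (h.antilinear_part hs (τ.J x) y v)
  have h4 := congrArg τ.J (h.antilinear_part hs x (τ.J y) v)
  simp only [Manti, map_add, map_sub, map_neg, map_smul, map_zero, τ.T_J, τ.T_J_right, τ.S_J,
    τ.S_J_right, τ.M_J_right, τ.J_J, LinearMap.add_apply, LinearMap.sub_apply, LinearMap.neg_apply,
    LinearMap.smul_apply] at h1 h2 h3 h4 ⊢
  -- This combination is the projection onto the part antilinear in `x` and linear in `y`.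
  linear_combination (norm := module) (1 / 4 : ℝ) • (h1 + h2 + h3 - h4)

theorem Nhol_eq (h : τ.KahlerLike t s) (hs : s ≠ 0) (x v w : E) :
    τ.Nhol x v w = -t • (τ.T v (τ.T x w) + τ.T (τ.T x v) w) := by
  refine τ.ext_g fun y => ?_
  rw [τ.g_symm, ← τ.g_Manti, h.Manti_eq hs, τ.g_symm (-t • _)]
  simp only [map_add, map_smul, LinearMap.add_apply, LinearMap.smul_apply]
  rw [τ.g_symm w, τ.S_spec, τ.S_spec, τ.g_symm w, τ.S_spec, τ.g_symm y, τ.g_symm y]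

/-- The complex-linear part of the curvature. -/
theorem linear_part (h : τ.KahlerLike t s) (hs : s ≠ 0) (x y v : E) :
    τ.curv t s x y v = τ.R x y v + t • (τ.M x y v - τ.N x y v - τ.M y x v + τ.N y x v)
      + (2 * t) • (τ.S (τ.T x y) v - τ.T (τ.T x y) v)
      + t ^ 2 • (τ.S x (τ.S y v - τ.T y v) - τ.T x (τ.S y v - τ.T y v)
        - τ.S y (τ.S x v - τ.T x v) + τ.T y (τ.S x v - τ.T x v))
      + s ^ 2 • (τ.S (τ.S v y) x - τ.S (τ.S v x) y) := by
  have h1 := h.antilinear_part hs x y v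
  simp only [curv, diff, diffDeriv, map_add, map_sub, map_neg, map_smul,
    LinearMap.add_apply, LinearMap.sub_apply, LinearMap.neg_apply, LinearMap.smul_apply] at h1 ⊢
  linear_combination (norm := module) s • h1

/-- The type condition removes the part complex bilinear in `x, y`. The Chern curvature and the `s²`
terms are of type (1,1) there and do not contribute; what remains has a factor `t`. -/
theorem linear_part_two_zero (h : τ.KahlerLike t s) (hs : s ≠ 0) (ht : t ≠ 0) (x y v : E) :
    τ.Nhol y x v - τ.Nhol x y v - (2 : ℝ) • τ.T (τ.T x y) v
      + t • (τ.T x (τ.T y v) - τ.T y (τ.T x v)) = 0 := by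
  have h1 := h.type x y v
  have h2 := congrArg τ.J (h.type (τ.J x) y v)
  simp only [h.linear_part hs] at h1 h2
  refine (smul_eq_zero_iff_right ht).1 ?_
  simp only [Nhol, map_add, map_sub, map_neg, map_smul, τ.T_J, τ.T_J_right, τ.S_J, τ.S_J_right,
    τ.N_J, τ.M_J, τ.R_J_J, τ.R_J, τ.J_J, LinearMap.add_apply,
    LinearMap.sub_apply, LinearMap.neg_apply, LinearMap.smul_apply] at h1 h2 ⊢
  linear_combination (norm := module) (1 / 4 : ℝ) • (h2 - h1)

/-- Substituting `Nhol_eq` cancels the commutator of `T_x` and `T_y` and leaves `2 (t - 1)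
T(T(x,y),v)`. -/
theorem T_T_eq_zero (h : τ.KahlerLike t s) (hs : s ≠ 0) (ht : t ≠ 0) (ht1 : t ≠ 1) (x y v : E) :
    τ.T (τ.T x y) v = 0 := by
  have h1 := h.linear_part_two_zero hs ht x y v
  rw [h.Nhol_eq hs, h.Nhol_eq hs, τ.T_swap y x] at h1
  simp only [map_neg, LinearMap.neg_apply] at h1
  refine (smul_eq_zero_iff_right (sub_ne_zero.2 ht1)).1 ?_
  linear_combination (norm := module) (1 / 2 : ℝ) • h1

theorem curv_swap (h : τ.KahlerLike t s) (hs : s ≠ 0) (x y v : E) :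
    τ.curv t s x y v = -τ.curv t s y x v := by
  rw [h.linear_part hs, h.linear_part hs, τ.R_swap x y, τ.T_swap x y]
  simp only [map_neg, LinearMap.neg_apply]
  module

/-- Adding `J` of the value at `Jy` kills what is linear in `y` and doubles what is antilinear. For
a curvature of type (1,1) the result is linear in `x`, hence the surviving terms. -/
theorem curv_one_one (h : τ.KahlerLike t s) (hs : s ≠ 0) (x y z : E) :
    τ.curv t s x y z + τ.J (τ.curv t s x (τ.J y) z) =
      τ.R x y z + τ.J (τ.R x (τ.J y) z) + (2 * t) • (τ.Nanti y x z + τ.Mhol x y z)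
        + (2 * t ^ 2) • (τ.S y (τ.T x z) - τ.T x (τ.S y z)) + (2 * s ^ 2) • τ.S (τ.S z y) x := by
  have h1 := h.linear_part hs x y z
  have h2 := h.linear_part hs (τ.J x) (τ.J y) z
  have h3 := congrArg τ.J (h.linear_part hs (τ.J x) y z)
  have h4 := congrArg τ.J (h.linear_part hs x (τ.J y) z)
  have e : τ.curv t s (τ.J x) y z = -τ.curv t s x (τ.J y) z := by
    rw [← h.type x, τ.J_J]
    simp only [h.linear_part hs, map_neg, map_sub, LinearMap.neg_apply]
    module
  rw [h.type] at h2
  rw [e] at h3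
  simp only [Nanti, Mhol, map_add, map_sub, map_neg, map_smul, τ.T_J, τ.T_J_right, τ.S_J,
    τ.S_J_right, τ.N_J, τ.M_J, τ.R_J_J, τ.R_J, τ.J_J, LinearMap.add_apply, LinearMap.sub_apply,
    LinearMap.neg_apply, LinearMap.smul_apply] at h1 h2 h3 h4 ⊢
  linear_combination (norm := module) (1 / 2 : ℝ) • (h1 + h2 - h3 + h4)

/-- The cyclic identities of the two curvatures are compared in the component antilinear in `y` and
linear in `x, z`. The terms `T(T(·,·),·)` have no such component, and the difference of the `Mhol`
terms is eliminated by `antilinear_part_two_zero`. -/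
theorem Nanti_eq (h : τ.KahlerLike t s) (hs : s ≠ 0) (x y z : E) :
    (2 * (1 - t)) • (τ.Nanti y x z + t • τ.S y (τ.T x z))
      = (s ^ 2 - t ^ 2) • (τ.S (τ.S z y) x - τ.S (τ.S x y) z) := by
  have e := h.antilinear_part_two_zero hs x z y
  have h1 := h.cyclic x y z
  have h2 := congrArg τ.J (h.cyclic x (τ.J y) z)
  have b1 := τ.bianchi x y z
  have b2 := congrArg τ.J (τ.bianchi x (τ.J y) z)
  have c1 := h.curv_one_one hs x y z
  have c2 := h.curv_one_one hs z y x
  rw [h.comm, h.curv_swap hs _ z x] at h2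
  rw [h.curv_swap hs y z x] at h1
  rw [τ.R_comp_J, τ.R_swap _ z x] at b2
  rw [τ.R_swap y z x] at b1
  have n : τ.Nanti y z x = -τ.Nanti y x z := by
    simp only [Nanti, τ.N_swap _ z x, map_neg]; module
  rw [n, τ.T_swap z x] at c2
  simp only [Nanti, map_add, map_sub, map_neg, map_smul, map_zero, τ.T_J, τ.T_J_right, τ.N_J,
    τ.N_J_right, τ.J_J, τ.N_swap _ z x, LinearMap.neg_apply] at e h1 h2 b1 b2 c1 c2 ⊢
  linear_combination (norm := module)
    (1 / 2 : ℝ) • (b1 + b2 - h1 - h2 + c1 - c2) + t • e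

end KahlerLike
end TorsionJet

/-! ### Vanishing of the torsion, according to the value of `t` -/

namespace TorsionJet

variable {E : Type*} [AddCommGroup E] [Module ℝ E] {τ : TorsionJet E} {t s : ℝ}

section Basis

variable (τ)

theorem exists_orthonormal_basis [FiniteDimensional ℝ E] :
    ∃ b : Module.Basis (Fin (Module.finrank ℝ E)) ℝ E,
      ∀ i j, τ.g (b i) (b j) = if i = j then 1 else 0 := by
  let c : InnerProductSpace.Core ℝ E :=
    { inner := fun v w => τ.g v w
      conj_inner_symm := fun v w => τ.g_symm w v
      re_inner_nonneg := fun v => by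
        rcases eq_or_ne v 0 with rfl | hv
        · simp
        · exact (τ.g_pos v hv).le
      add_left := fun u v w => by simp
      smul_left := fun u v r => by simp
      definite := fun v h => τ.eq_zero_of_g h }
  let _ : NormedAddCommGroup E := c.toNormedAddCommGroup
  let _ : InnerProductSpace ℝ E := InnerProductSpace.ofCore c.toCore
  let b := stdOrthonormalBasis ℝ E
  refine ⟨b.toBasis, fun i j => ?_⟩
  have := orthonormal_iff_ite.1 b.orthonormal i j
  rw [b.coe_toBasis]
  exact this

variable {ι : Type*} [Fintype ι] [DecidableEq ι] (b : Module.Basis ι ℝ E)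
  (hb : ∀ i j, τ.g (b i) (b j) = if i = j then 1 else 0)

include hb

theorem repr_eq_g (v : E) (i : ι) : b.repr v i = τ.g v (b i) := by
  conv_rhs => rw [← b.sum_repr v]
  simp only [map_sum, map_smul, LinearMap.sum_apply, LinearMap.smul_apply, hb, smul_eq_mul,
    mul_ite, mul_one, mul_zero, Finset.sum_ite_eq', Finset.mem_univ, if_true]

theorem g_eq_sum (v w : E) : τ.g v w = ∑ i, τ.g v (b i) * τ.g w (b i) := by
  conv_lhs => rw [← b.sum_repr w]
  simp only [map_sum, map_smul, τ.repr_eq_g b hb, smul_eq_mul]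
  exact Finset.sum_congr rfl fun i _ => mul_comm _ _

theorem trace_eq_sum (f : E →ₗ[ℝ] E) : LinearMap.trace ℝ E f = ∑ i, τ.g (f (b i)) (b i) := by
  rw [LinearMap.trace_eq_matrix_trace ℝ b, Matrix.trace]
  simp [LinearMap.toMatrix_apply, τ.repr_eq_g b hb]

/-- An operator and its adjoint have the same Hilbert–Schmidt norm. -/
theorem sum_g_S_eq_sum_g_T (x : E) :
    ∑ i, τ.g (τ.S x (b i)) (τ.S x (b i)) = ∑ i, τ.g (τ.T x (b i)) (τ.T x (b i)) := by
  have h1 : ∀ i, τ.g (τ.S x (b i)) (τ.S x (b i))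
      = ∑ j, τ.g (τ.T x (b j)) (b i) * τ.g (τ.T x (b j)) (b i) := fun i => by
    rw [τ.g_eq_sum b hb]
    simp only [τ.S_spec, τ.g_symm (b i)]
  simp only [h1, τ.g_eq_sum b hb (τ.T x _) (τ.T x _)]
  exact Finset.sum_comm

end Basis

theorem g_nonneg (v : E) : 0 ≤ τ.g v v := by
  rcases eq_or_ne v 0 with rfl | hv
  · simp
  · exact (τ.g_pos v hv).le

theorem T_self (u : E) : τ.T u u = 0 := by
  have h := τ.T_swap u u
  refine (smul_eq_zero_iff_right (two_ne_zero (α := ℝ))).1 ?_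
  rw [two_smul]
  nth_rewrite 1 [h]
  simp

theorem T_eq_zero_of_S (h : ∀ u v, τ.S u v = 0) (u v : E) : τ.T u v = 0 := by
  refine τ.eq_zero_of_g ?_
  rw [← τ.S_spec, h]; simp

/-- Adjunction and skewness of `T` turn an iterated `S` into an inner product of two values of `S`;
this is the source of the squared norms below. -/
theorem g_S_S (i j k l : E) : τ.g (τ.S (τ.S k l) i) j = -τ.g (τ.S j i) (τ.S k l) := by
  rw [τ.S_spec, τ.S_spec, τ.T_swap]; simp

namespace KahlerLike

/-- At `t = 1` the left side of `Nanti_eq` vanishes, so `S_{S_z y} x` is symmetric in `x, z`. By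
`g_S_S` this yields `|S_y x|² = g(S_y y, S_x x)`, and it suffices to kill the diagonal values. -/
theorem T_eq_zero_of_one (h : τ.KahlerLike 1 s) (hs : s ≠ 0) (hs1 : s ^ 2 ≠ 1) (u v : E) :
    τ.T u v = 0 := by
  have h1 : ∀ x y z, τ.S (τ.S z y) x = τ.S (τ.S x y) z := fun x y z => by
    have h2 := h.Nanti_eq hs x y z
    rw [sub_self, mul_zero, zero_smul, one_pow] at h2
    exact sub_eq_zero.1 ((smul_eq_zero_iff_right (sub_ne_zero.2 hs1)).1 h2.symm)
  have h2 : ∀ x y, τ.g (τ.S y x) (τ.S y x) = τ.g (τ.S y y) (τ.S x x) := fun x y => by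
    have e1 := τ.g_S_S x y y x
    have e2 := τ.g_S_S y y x x
    rw [h1] at e1
    linarith
  have h3 : ∀ x, τ.S x x = 0 := fun x => by
    refine τ.eq_zero_of_g ?_
    -- With `y = S_x x`, the right side of `h2` is `g(y, T_y y) = 0`.
    have e : τ.S (τ.S x x) x = 0 := by
      refine τ.eq_zero_of_g ?_
      rw [h2, τ.S_spec, τ.T_self, map_zero]
    have e1 := τ.g_S_S x x x x
    rw [e] at e1
    simpa using e1
  refine T_eq_zero_of_S (fun y x => τ.eq_zero_of_g ?_) u v
  rw [h2, h3]; simp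

theorem T_eq_zero_of_ne (h : τ.KahlerLike t s) (hs : s ≠ 0) (ht : t ≠ 0) (ht1 : t ≠ 1) (u v : E) :
    τ.T u v = 0 := by
  have hTT := h.T_T_eq_zero hs ht ht1
  have hSS : ∀ x y z, τ.S x (τ.S y z) = 0 := fun x y z => τ.ext_g fun w => by
    rw [τ.S_spec, τ.S_spec, τ.T_swap, hTT]; simp
  -- For `x, y` orthogonal to the image of `T`, the pairings reduce to `2 (1 - t)² |T(x,y)|² = 0`.
  have h0 : ∀ x y, (∀ u, τ.S u x = 0) → (∀ u, τ.S u y = 0) → τ.T x y = 0 := fun x y hx hy => by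
    have e := congrArg (fun p => τ.g p y) (h.antilinear_part_two_zero hs x y x)
    have n1 := congrArg (fun p => τ.g p y) (h.Nanti_eq hs x x y)
    have n2 := congrArg (fun p => τ.g p x) (h.Nanti_eq hs x y y)
    simp only [map_add, map_sub, map_smul, map_zero, LinearMap.add_apply, LinearMap.sub_apply,
      LinearMap.smul_apply, LinearMap.zero_apply, g_Mhol, hx, hy, smul_eq_mul, smul_zero,
      τ.S_spec, τ.T_swap y x, map_neg, sub_zero, add_zero] at e n1 n2
    rw [τ.g_symm y, τ.g_symm x] at e
    refine τ.eq_zero_of_g ((mul_eq_zero_iff_left (mul_ne_zero (two_ne_zero (α := ℝ))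
      (mul_self_ne_zero.2 (sub_ne_zero.2 ht1)))).1 ?_)
    linear_combination (1 - t) * e - n1 / 2 + n2 / 2
  -- By `hSS`, every value of `S` satisfies the hypothesis of `h0`.
  have h1 : ∀ a b c d, τ.T (τ.S a b) (τ.S c d) = 0 := fun a b c d =>
    h0 _ _ (fun u => hSS _ _ _) fun u => hSS _ _ _
  have h2 : ∀ a b c d e, τ.g (τ.S c d) (τ.S (τ.S a b) e) = 0 := fun a b c d e => by
    rw [τ.g_symm, τ.S_spec, h1, map_zero]
  have h3 : ∀ a b c, τ.S (τ.S a b) c = 0 := fun a b c => τ.eq_zero_of_g (h2 _ _ _ _ _)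
  refine T_eq_zero_of_S (fun y x => τ.eq_zero_of_g ?_) u v
  rw [τ.S_spec, τ.T_swap, map_neg, ← τ.S_spec, h3]
  simp

/-- At `t = 0` the derivative of `T` has no (1,0) part and the Chern curvature no (2,0) part, so the
complex trilinear part of the Bianchi identity is the Jacobi identity. -/
theorem jacobi (h : τ.KahlerLike 0 s) (hs : s ≠ 0) (x y z : E) :
    τ.T (τ.T x y) z + τ.T (τ.T y z) x + τ.T (τ.T z x) y = 0 := by
  have hN : ∀ x u v, τ.N x u v = τ.J (τ.N (τ.J x) u v) := fun x u v => by
    have e := h.Nhol_eq hs x u v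
    rw [neg_zero, zero_smul, Nhol, smul_eq_zero_iff_right (by norm_num)] at e
    exact sub_eq_zero.1 e
  have hN' : ∀ x u v, τ.N (τ.J x) u v = -τ.J (τ.N x u v) := fun x u v => by
    rw [hN x, τ.J_J, neg_neg]
  have b1 := τ.bianchi x y z
  have b2 := τ.bianchi (τ.J x) (τ.J y) z
  have b3 := τ.bianchi x (τ.J y) (τ.J z)
  have b4 := τ.bianchi (τ.J x) y (τ.J z)
  simp only [hN', map_neg, τ.T_J, τ.T_J_right, τ.N_J, τ.N_J_right, τ.J_J, τ.R_J_J, τ.R_J,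
    τ.R_comp_J, LinearMap.neg_apply] at b1 b2 b3 b4
  -- The signed sum is 4 times the complex trilinear part, in which the Jacobi sum has coefficient
  -- 4.
  linear_combination (norm := module) (1 / 16 : ℝ) • (b2 + b3 + b4 - b1)

/-- For such `x` the identities give `4 |T_x j|² = s² |S_x j|²`; summing over an orthonormal basis
compares equal Hilbert–Schmidt norms, and `s² ≠ 4` decides. -/
theorem T_eq_zero_of_orthogonal [FiniteDimensional ℝ E] (h : τ.KahlerLike 0 s) (hs : s ≠ 0)
    (hs4 : s ^ 2 ≠ 4) {x : E} (hx : ∀ u v, τ.g x (τ.T u v) = 0) (u : E) : τ.T x u = 0 := by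
  have hx' : ∀ a, τ.S a x = 0 := fun a => τ.ext_g fun w => by rw [τ.S_spec, hx]; simp
  have h1 : ∀ j, 4 * τ.g (τ.T x j) (τ.T x j) = s ^ 2 * τ.g (τ.S x j) (τ.S x j) := fun j => by
    have e := congrArg (fun p => τ.g p j) (h.antilinear_part_two_zero hs x j x)
    have n1 := congrArg (fun p => τ.g j p) (h.Nanti_eq hs x x j)
    have n2 := congrArg (fun p => τ.g x p) (h.Nanti_eq hs x j j)
    have n3 := τ.g_S_S j x x j
    simp only [map_add, map_sub, map_smul, map_zero, LinearMap.add_apply, LinearMap.sub_apply,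
      LinearMap.smul_apply, LinearMap.zero_apply, g_Mhol, hx', smul_eq_mul, smul_zero, zero_smul,
      sub_zero, add_zero] at e n1 n2
    rw [τ.S_spec, τ.g_symm x] at e
    rw [τ.g_symm x, τ.g_symm x, n3] at n2
    linear_combination 2 * e - n1 + n2
  obtain ⟨b, hb⟩ := τ.exists_orthonormal_basis
  have h2 := Finset.sum_congr (rfl : Finset.univ = Finset.univ) fun i _ => h1 (b i)
  rw [← Finset.mul_sum, ← Finset.mul_sum, τ.sum_g_S_eq_sum_g_T b hb] at h2
  have h3 : ∑ i, τ.g (τ.T x (b i)) (τ.T x (b i)) = 0 := by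
    refine (mul_eq_zero_iff_left (sub_ne_zero.2 hs4)).1 ?_
    linear_combination -h2
  rw [Finset.sum_eq_zero_iff_of_nonneg fun i _ => g_nonneg _] at h3
  have h4 : τ.T x = 0 := b.ext fun i => τ.eq_zero_of_g (h3 i (Finset.mem_univ i))
  rw [h4, LinearMap.zero_apply]

/-- By Jacobi, `T_{T(a,b)}` is a commutator and has trace zero. So the vector dual to `u ↦ tr T_u`
is orthogonal to the image of `T`, hence acts by zero, and its squared norm is the trace of that
action. -/
theorem trace_T [FiniteDimensional ℝ E] (h : τ.KahlerLike 0 s) (hs : s ≠ 0)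
    (hs4 : s ^ 2 ≠ 4) (u : E) : LinearMap.trace ℝ E (τ.T u) = 0 := by
  have h1 : ∀ a b, LinearMap.trace ℝ E (τ.T (τ.T a b)) = 0 := fun a b => by
    have e : τ.T (τ.T a b) = τ.T a * τ.T b - τ.T b * τ.T a := by
      ext z
      have e1 := h.jacobi hs a b z
      rw [τ.T_swap (τ.T b z), τ.T_swap (τ.T z a), τ.T_swap z a, map_neg] at e1
      rw [LinearMap.sub_apply, Module.End.mul_apply, Module.End.mul_apply]
      linear_combination (norm := module) e1
    rw [e, map_sub, LinearMap.trace_mul_comm, sub_self]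
  obtain ⟨b, hb⟩ := τ.exists_orthonormal_basis
  set x := ∑ i, LinearMap.trace ℝ E (τ.T (b i)) • b i with hx
  have h2 : ∀ v, τ.g x v = LinearMap.trace ℝ E (τ.T v) := fun v => by
    conv_rhs => rw [← b.sum_repr v]
    simp only [hx, map_sum, map_smul, LinearMap.sum_apply, LinearMap.smul_apply, smul_eq_mul,
      τ.repr_eq_g b hb]
    exact Finset.sum_congr rfl fun i _ => by rw [τ.g_symm, mul_comm]
  have h3 : τ.T x = 0 := LinearMap.ext fun w =>
    h.T_eq_zero_of_orthogonal hs hs4 (fun u v => by rw [h2, h1]) w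
  have h4 : x = 0 := τ.eq_zero_of_g (by rw [h2, h3, map_zero])
  rw [← h2, h4]; simp

/-- In the trace of `Nanti_eq` at `(y, y, ·)` the derivative term vanishes by `hN` and the `S_{S_y
y}` term by `trace_T`. What is left is the sum of the `|S_{b_i} y|²`. -/
theorem T_eq_zero_of_zero [FiniteDimensional ℝ E] (h : τ.KahlerLike 0 s) (hs : s ≠ 0)
    (hs4 : s ^ 2 ≠ 4) (hN : ∀ x u, LinearMap.trace ℝ E (τ.N x u) = 0) (u v : E) :
    τ.T u v = 0 := by
  obtain ⟨b, hb⟩ := τ.exists_orthonormal_basis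
  refine T_eq_zero_of_S (fun z y => ?_) u v
  have h1 : ∀ z, (2 : ℝ) • τ.Nanti y y z = s ^ 2 • (τ.S (τ.S z y) y - τ.S (τ.S y y) z) :=
    fun z => by simpa using h.Nanti_eq hs y y z
  have h2 : ∑ i, τ.g (τ.Nanti y y (b i)) (b i) = 0 := by
    have e := τ.trace_eq_sum b hb ((1 / 2 : ℝ) • (τ.N y y + τ.N (τ.J y) (τ.J y)))
    rw [map_smul, map_add, hN, hN, add_zero, smul_zero] at e
    rw [e]
    exact Finset.sum_congr rfl fun i _ => by
      rw [LinearMap.smul_apply, LinearMap.add_apply, τ.N_J, Nanti]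
  have h3 : ∑ i, τ.g (τ.S (τ.S y y) (b i)) (b i) = 0 := by
    rw [← h.trace_T hs hs4 (τ.S y y), τ.trace_eq_sum b hb]
    exact Finset.sum_congr rfl fun i _ => by rw [τ.S_spec, τ.g_symm]
  have h4 : ∑ i, τ.g (τ.S (b i) y) (τ.S (b i) y) = 0 := by
    refine (mul_eq_zero_iff_left (pow_ne_zero 2 hs)).1 ?_
    have e : ∀ i, s ^ 2 * τ.g (τ.S (b i) y) (τ.S (b i) y)
        = -2 * τ.g (τ.Nanti y y (b i)) (b i) - s ^ 2 * τ.g (τ.S (τ.S y y) (b i)) (b i) :=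
      fun i => by
      have e1 := congrArg (fun p => τ.g p (b i)) (h1 (b i))
      simp only [map_smul, map_sub, LinearMap.smul_apply, LinearMap.sub_apply, smul_eq_mul,
        τ.g_S_S y (b i) (b i) y] at e1
      linear_combination e1
    rw [Finset.mul_sum]
    simp only [e]
    rw [Finset.sum_sub_distrib, ← Finset.mul_sum, ← Finset.mul_sum, h2, h3]
    simp
  rw [Finset.sum_eq_zero_iff_of_nonneg fun i _ => g_nonneg _] at h4
  have h5 : τ.S.flip y = 0 :=
    b.ext fun i => τ.eq_zero_of_g (h4 i (Finset.mem_univ i))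
  exact LinearMap.congr_fun h5 z

end KahlerLike
end TorsionJet

/-! ### Multilinear maps from functions linear in each variable -/

theorem exists_bilinear {E F : Type*} [AddCommGroup E] [Module ℝ E] [AddCommGroup F] [Module ℝ F]
    (f : E → E → F)
    (h1 : ∀ (a : ℝ) x x' y, f (a • x + x') y = a • f x y + f x' y)
    (h2 : ∀ (a : ℝ) x y y', f x (a • y + y') = a • f x y + f x y') :
    ∃ B : E →ₗ[ℝ] E →ₗ[ℝ] F, ∀ x y, B x y = f x y := by
  have z1 : ∀ y, f 0 y = 0 := fun y => by simpa using h1 1 0 0 y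
  have z2 : ∀ x, f x 0 = 0 := fun x => by simpa using h2 1 x 0 0
  exact ⟨LinearMap.mk₂ ℝ f (fun x x' y => by simpa using h1 1 x x' y)
    (fun a x y => by simpa [z1] using h1 a x 0 y) (fun x y y' => by simpa using h2 1 x y y')
    (fun a x y => by simpa [z2] using h2 a x y 0), fun x y => rfl⟩

theorem exists_trilinear {E F : Type*} [AddCommGroup E] [Module ℝ E] [AddCommGroup F] [Module ℝ F]
    (f : E → E → E → F)
    (h1 : ∀ (a : ℝ) x x' y z, f (a • x + x') y z = a • f x y z + f x' y z)
    (h2 : ∀ (a : ℝ) x y y' z, f x (a • y + y') z = a • f x y z + f x y' z)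
    (h3 : ∀ (a : ℝ) x y z z', f x y (a • z + z') = a • f x y z + f x y z') :
    ∃ B : E →ₗ[ℝ] E →ₗ[ℝ] E →ₗ[ℝ] F, ∀ x y z, B x y z = f x y z := by
  choose B hB using fun x => exists_bilinear (f x) (h2 · x) (h3 · x)
  have h : ∀ (a : ℝ) x x', B (a • x + x') = a • B x + B x' := fun a x x' => by
    ext y z
    simp [hB, h1]
  have z1 : B 0 = 0 := by simpa using h 1 0 0
  exact ⟨{ toFun := B, map_add' := fun x x' => by simpa using h 1 x x',
           map_smul' := fun a x => by simpa [z1] using h a x 0 }, hB⟩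

/-! ### The connections in terms of the Chern torsion -/

section Pointwise

variable {E : Type*} [NormedAddCommGroup E] [NormedSpace ℂ E]
variable {G : E → E →L[ℝ] E →L[ℝ] ℝ} {z : E}

/-- Half of the torsion of the Chern connection. -/
noncomputable def torsion (G : E → E →L[ℝ] E →L[ℝ] ℝ) (z u v : E) : E :=
  (1 / 2 : ℝ) • (chernSymbol G z u v - chernSymbol G z v u)

/-- The adjoint of the torsion with respect to its second argument. -/
noncomputable def torsionAdjoint (G : E → E →L[ℝ] E →L[ℝ] ℝ) (z u v : E) : E :=
  raiseIndex (G z) ((1 / 4 : ℝ) • ((fderiv ℝ G z u).flip v + (fderiv ℝ G z (mulI E u)).flip (mulI E v)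
    - ((fderiv ℝ G z).flip u).flip v - (((fderiv ℝ G z).flip u).flip (mulI E v)).comp (mulI E)))

variable [FiniteDimensional ℂ E]

namespace IsHermitianNear

theorem chernSymbol_left (h : IsHermitianNear G z) (a : ℝ) (u u' v : E) :
    chernSymbol G z (a • u + u') v = a • chernSymbol G z u v + chernSymbol G z u' v :=
  h.ext fun w => by
    simp only [map_add, map_smul, add_apply, smul_apply, h.g_chern,
      smul_eq_mul]
    ring

theorem chernSymbol_right (h : IsHermitianNear G z) (a : ℝ) (u v v' : E) :
    chernSymbol G z u (a • v + v') = a • chernSymbol G z u v + chernSymbol G z u v' :=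
  h.ext fun w => by
    simp only [map_add, map_smul, add_apply, smul_apply, h.g_chern,
      smul_eq_mul]
    ring

theorem chernSymbol_mulI_left (h : IsHermitianNear G z) (u v : E) :
    chernSymbol G z (mulI E u) v = mulI E (chernSymbol G z u v) :=
  h.ext fun w => by
    rw [h.skew]
    simp only [h.g_chern, mulI_mulI, map_neg, neg_apply]
    ring

theorem g_torsion (h : IsHermitianNear G z) (u v w : E) :
    G z (torsion G z u v) w = (1 / 4) * (fderiv ℝ G z u v w + fderiv ℝ G z (mulI E u) v (mulI E w)
      - fderiv ℝ G z v u w - fderiv ℝ G z (mulI E v) u (mulI E w)) := by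
  simp only [torsion, map_smul, map_sub, sub_apply, smul_apply, h.g_chern,
    smul_eq_mul]
  ring

theorem g_torsionAdjoint (h : IsHermitianNear G z) (u v w : E) :
    G z (torsionAdjoint G z u v) w = G z v (torsion G z u w) := by
  rw [h.symm.self_of_nhds v, h.g_torsion, torsionAdjoint, raiseIndex_spec h.pos]
  simp only [smul_apply, sub_apply, add_apply, ContinuousLinearMap.flip_apply,
    ContinuousLinearMap.comp_apply, smul_eq_mul]

theorem leviCivitaSymbol_eq (h : IsHermitianNear G z) (u v : E) :
    leviCivitaSymbol G z u v = chernSymbol G z u v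
      + (torsionAdjoint G z u v - torsion G z u v + torsionAdjoint G z v u) :=
  h.ext fun w => by
    have hs : ∀ a b, G z a b = G z b a := fun a b => h.symm.self_of_nhds a b
    simp only [map_add, map_sub, add_apply, sub_apply, h.g_torsionAdjoint]
    rw [hs v, hs u]
    simp only [h.g_torsion, h.g_leviCivita, h.g_chern]
    linarith [
      h.d_symm u v w, h.d_skew (mulI E u) v w, h.d_skew (mulI E u) w v, h.d_symm (mulI E
      u) (mulI E v) w, h.d_symm (mulI E u) v (mulI E w), h.d_symm v u w, h.d_skew (mulI E
      v) u w, h.d_skew (mulI E v) w u, h.d_symm (mulI E v) (mulI E u) w, h.d_symm (mulI E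
      v) u (mulI E w), h.d_symm w u v, h.d_skew (mulI E w) u v, h.d_skew (mulI E w) v u,
      h.d_symm (mulI E w) (mulI E u) v, h.d_symm (mulI E w) u (mulI E v)]

theorem stromingerSymbol_eq (h : IsHermitianNear G z) (u v : E) :
    stromingerSymbol G z u v = chernSymbol G z u v
      + (2 : ℝ) • (torsionAdjoint G z u v - torsion G z u v) :=
  h.ext fun w => by
    simp only [map_add, map_sub, map_smul, smul_apply, smul_eq_mul, add_apply, sub_apply,
      h.g_torsionAdjoint]
    rw [h.symm.self_of_nhds v]
    simp only [h.g_torsion, h.g_strominger, h.g_leviCivita, h.g_chern, h.dOmega_apply, mulI_mulI,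
      map_neg, neg_apply]
    linarith [
      h.d_symm u v w, h.d_skew (mulI E u) v w, h.d_skew (mulI E u) w v, h.d_symm (mulI E
      u) (mulI E v) w, h.d_symm (mulI E u) v (mulI E w), h.d_symm v u w, h.d_skew (mulI E
      v) u w, h.d_skew (mulI E v) w u, h.d_symm (mulI E v) (mulI E u) w, h.d_symm (mulI E
      v) u (mulI E w), h.d_symm w u v, h.d_skew (mulI E w) u v, h.d_skew (mulI E w) v u,
      h.d_symm (mulI E w) (mulI E u) v, h.d_symm (mulI E w) u (mulI E v)]

/-- The coefficient `t` arises from Strominger (twice `S - T`, weight `(1-s)(1-r)/2`) and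
Levi-Civita (once, weight `s`); only Levi-Civita contributes `S_v u`. -/
theorem canonicalSymbol_eq (h : IsHermitianNear G z) (r s : ℝ) (u v : E) :
    canonicalSymbol G r s z u v = chernSymbol G z u v
      + (((1 - s) * (1 - r) + s) • (torsionAdjoint G z u v - torsion G z u v)
        + s • torsionAdjoint G z v u) := by
  rw [canonicalSymbol, gauduchonSymbol, h.leviCivitaSymbol_eq, h.stromingerSymbol_eq]
  module

/-- The Chern connection preserves `g` and `J`, hence `ω`; a form parallel for a torsion-free
connection is closed. -/
theorem dOmega_eq_zero (h : IsHermitianNear G z) (h0 : ∀ u v, torsion G z u v = 0) (u v w : E) :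
    dOmegaLocal G z u v w = 0 := by
  have hT : ∀ u v, chernSymbol G z u v = chernSymbol G z v u := fun u v => by
    have e := h0 u v
    rw [torsion, smul_eq_zero_iff_right (by norm_num)] at e
    exact sub_eq_zero.1 e
  have hd := (chern_spec h).1
  have hJ := (chern_spec h).2.1
  rw [h.dOmega_apply, ← hd, ← hd, ← hd, hJ, hJ, hJ]
  have hs : ∀ a b, G z a b = G z b a := fun a b => h.symm.self_of_nhds a b
  have e : ∀ a b, G z (mulI E a) b = -G z (mulI E b) a := fun a b => by rw [h.skew, hs, neg_inj]
  rw [hT v u, hT w u, hT w v]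
  linarith [e (chernSymbol G z u w) v]

end IsHermitianNear
end Pointwise

/-! ### Smooth dependence on the point and the Chern curvature -/

section Smooth

variable {E : Type*} [NormedAddCommGroup E] [NormedSpace ℂ E]

/-- `G` is a smooth Hermitian metric on the open set `U`. -/
structure IsHermitianOn (G : E → E →L[ℝ] E →L[ℝ] ℝ) (U : Set E) : Prop where
  isOpen : IsOpen U
  smooth : ContDiffOn ℝ ∞ G U
  pos : ∀ z ∈ U, ∀ v, v ≠ 0 → 0 < G z v v
  symm : ∀ z ∈ U, ∀ v w, G z v w = G z w v
  inv : ∀ z ∈ U, ∀ v w, G z (mulI E v) (mulI E w) = G z v w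

namespace IsHermitianOn

variable {G : E → E →L[ℝ] E →L[ℝ] ℝ} {U : Set E} {z : E}

theorem near (hG : IsHermitianOn G U) (hz : z ∈ U) : IsHermitianNear G z where
  diff := (hG.smooth.contDiffAt (hG.isOpen.mem_nhds hz)).differentiableAt (by simp)
  pos := hG.pos z hz
  symm := Filter.eventually_of_mem (hG.isOpen.mem_nhds hz) hG.symm
  inv := Filter.eventually_of_mem (hG.isOpen.mem_nhds hz) hG.inv

theorem contDiffOn_apply (hG : IsHermitianOn G U) (v w : E) :
    ContDiffOn ℝ ∞ (fun y => G y v w) U :=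
  (hG.smooth.clm_apply contDiffOn_const).clm_apply contDiffOn_const

theorem contDiffOn_fderiv (hG : IsHermitianOn G U) (u v w : E) :
    ContDiffOn ℝ ∞ (fun y => fderiv ℝ G y u v w) U := by
  have h := (hG.contDiffOn_apply v w).fderiv_of_isOpen (m := ∞) hG.isOpen (by simp)
  exact (h.clm_apply (contDiffOn_const (c := u))).congr
    fun y hy => (fderiv_apply₂ (hG.near hy).diff u v w).symm

theorem differentiableAt (hG : IsHermitianOn G U) (hz : z ∈ U) {F : Type*} [NormedAddCommGroup F]
    [NormedSpace ℝ F] {f : E → F} (hf : ContDiffOn ℝ ∞ f U) : DifferentiableAt ℝ f z :=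
  (hf.contDiffAt (hG.isOpen.mem_nhds hz)).differentiableAt (by simp)

theorem fderiv_mulI_comp {f : E → E} (hf : DifferentiableAt ℝ f z) (x : E) :
    fderiv ℝ (fun y => mulI E (f y)) z x = mulI E (fderiv ℝ f z x) := by
  have h : HasFDerivAt (fun y => mulI E (f y)) _ z :=
    (mulI E).hasFDerivAt.comp z hf.hasFDerivAt
  rw [h.fderiv]
  rfl

variable [FiniteDimensional ℂ E]

theorem contDiffOn_raiseIndex (hG : IsHermitianOn G U) {α : E → E →L[ℝ] ℝ}
    (hα : ∀ w, ContDiffOn ℝ ∞ (fun y => α y w) U) :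
    ContDiffOn ℝ ∞ (fun y => raiseIndex (G y) (α y)) U := by
  have : FiniteDimensional ℝ E := FiniteDimensional.complexToReal E
  have : CompleteSpace E := FiniteDimensional.complete ℝ E
  refine ContDiffOn.clm_apply (fun z hz => ?_) (contDiffOn_clm_apply.2 hα)
  have hinj : Function.Injective (G z).toLinearMap := by
    rw [injective_iff_map_eq_zero]
    intro v hv
    by_contra hne
    have h := hG.pos z hz v hne
    have h2 : G z v = 0 := hv
    simp [h2] at h
  have hfr : Module.finrank ℝ E = Module.finrank ℝ (E →L[ℝ] ℝ) := by
    rw [← (LinearMap.toContinuousLinearMap (𝕜 := ℝ) (E := E) (F' := ℝ)).finrank_eq]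
    exact (Subspace.dual_finrank_eq (K := ℝ) (V := E)).symm
  let e : E ≃L[ℝ] (E →L[ℝ] ℝ) :=
    (LinearEquiv.ofInjectiveOfFinrankEq (G z).toLinearMap hinj hfr).toContinuousLinearEquiv
  have he : (e : E →L[ℝ] (E →L[ℝ] ℝ)) = G z := by ext v w; rfl
  have h1 : ContDiffAt ℝ ∞ ContinuousLinearMap.inverse (G z) := he ▸ contDiffAt_map_inverse e
  exact h1.comp_contDiffWithinAt z (hG.smooth z hz)

theorem contDiffOn_chernSymbol (hG : IsHermitianOn G U) (u v : E) :
    ContDiffOn ℝ ∞ (fun y => chernSymbol G y u v) U :=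
  hG.contDiffOn_raiseIndex fun w =>
    ((hG.contDiffOn_fderiv u v w).add
      (hG.contDiffOn_fderiv (mulI E u) v (mulI E w))).const_smul (1 / 2 : ℝ)

theorem contDiffOn_torsion (hG : IsHermitianOn G U) (u v : E) :
    ContDiffOn ℝ ∞ (fun y => torsion G y u v) U :=
  ((hG.contDiffOn_chernSymbol u v).sub (hG.contDiffOn_chernSymbol v u)).const_smul (1 / 2 : ℝ)

theorem contDiffOn_torsionAdjoint (hG : IsHermitianOn G U) (u v : E) :
    ContDiffOn ℝ ∞ (fun y => torsionAdjoint G y u v) U :=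
  hG.contDiffOn_raiseIndex fun w =>
    (((hG.contDiffOn_fderiv u w v).add (hG.contDiffOn_fderiv (mulI E u) w (mulI E v))).sub
      (hG.contDiffOn_fderiv w u v) |>.sub
      (hG.contDiffOn_fderiv (mulI E w) u (mulI E v))).const_smul (1 / 4 : ℝ)

/-- The derivative of the Christoffel symbol of the Chern connection is real-trilinear. -/
theorem exists_fderiv_chernSymbol (hG : IsHermitianOn G U) (hz : z ∈ U) :
    ∃ D : E →ₗ[ℝ] E →ₗ[ℝ] E →ₗ[ℝ] E,
      ∀ x u v, D x u v = fderiv ℝ (fun y => chernSymbol G y u v) z x := by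
  have hd := fun u v => hG.differentiableAt hz (hG.contDiffOn_chernSymbol u v)
  have hn := hG.isOpen.mem_nhds hz
  refine exists_trilinear _ (fun a x x' u v => by simp) (fun a x u u' v => ?_)
    (fun a x u v v' => ?_)
  · rw [Filter.EventuallyEq.fderiv_eq (Filter.eventually_of_mem hn fun y hy =>
        (hG.near hy).chernSymbol_left a u u' v)]
    have h : HasFDerivAt (fun y => a • chernSymbol G y u v + chernSymbol G y u' v) _ z :=
      ((hd u v).hasFDerivAt.const_smul a).add (hd u' v).hasFDerivAt
    rw [h.fderiv]
    rfl
  · rw [Filter.EventuallyEq.fderiv_eq (Filter.eventually_of_mem hn fun y hy =>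
        (hG.near hy).chernSymbol_right a u v v')]
    have h : HasFDerivAt (fun y => a • chernSymbol G y u v + chernSymbol G y u v') _ z :=
      ((hd u v).hasFDerivAt.const_smul a).add (hd u v').hasFDerivAt
    rw [h.fderiv]
    rfl

/-- The product rule for the inner product, in terms of the Chern connection. -/
theorem fderiv_inner (hG : IsHermitianOn G U) (hz : z ∈ U) {f k : E → E}
    (hf : DifferentiableAt ℝ f z) (hk : DifferentiableAt ℝ k z) (x : E) :
    fderiv ℝ (fun y => G y (f y) (k y)) z x =
      G z (fderiv ℝ f z x + chernSymbol G z x (f z)) (k z)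
        + G z (f z) (fderiv ℝ k z x + chernSymbol G z x (k z)) := by
  have h := hG.near hz
  rw [((h.diff.hasFDerivAt.clm_apply hf.hasFDerivAt).clm_apply hk.hasFDerivAt).fderiv]
  have := (chern_spec h).1 x (f z) (k z)
  simp only [map_add, add_apply, ContinuousLinearMap.comp_apply, ContinuousLinearMap.flip_apply]
  linarith

/-- The Chern connection is metric, and therefore its curvature is skew-adjoint. -/
theorem chern_curvature_skew (hG : IsHermitianOn G U) (hz : z ∈ U) (x y v w : E) :
    G z (curvatureLocal (chernSymbol G) z x y v) w
      = -G z v (curvatureLocal (chernSymbol G) z x y w) := by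
  have hd := fun u v => hG.differentiableAt hz (hG.contDiffOn_chernSymbol u v)
  have hn := hG.isOpen.mem_nhds hz
  have e : ∀ x y, fderiv ℝ (fderiv ℝ fun p => G p v w) z x y
      = fderiv ℝ (fun p => G p (chernSymbol G p y v) w + G p v (chernSymbol G p y w)) z x :=
    fun x y => by
    have h1 : DifferentiableAt ℝ (fderiv ℝ fun p => G p v w) z := hG.differentiableAt hz
      ((hG.contDiffOn_apply v w).fderiv_of_isOpen (m := ∞) hG.isOpen (by simp))
    have h2 : fderiv ℝ (fun p => fderiv ℝ (fun p => G p v w) p y) z x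
        = fderiv ℝ (fderiv ℝ fun p => G p v w) z x y := by
      rw [(h1.hasFDerivAt.clm_apply (hasFDerivAt_const y z)).fderiv]; simp
    rw [← h2]
    congr 1
    refine Filter.EventuallyEq.fderiv_eq (Filter.eventually_of_mem hn fun p hp => ?_)
    exact (fderiv_apply₂ (hG.near hp).diff y v w).trans ((chern_spec (hG.near hp)).1 y v w).symm
  -- Second derivatives of `G(v, w)` commute; expanding both orders by metricity, their difference
  -- is the skewness of the curvature.
  have hs := (((hG.contDiffOn_apply v w).contDiffAt hn).isSymmSndFDerivAt (by simpa using (WithTop.coe_le_coe.2 le_top : ((2 : ℕ∞) : ℕ∞ω) ≤ ∞))).eq x y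
  have hc : ∀ (u : E), DifferentiableAt ℝ (fun _ : E => u) z := fun u => differentiableAt_const u
  have hi : ∀ {f k : E → E}, DifferentiableAt ℝ f z → DifferentiableAt ℝ k z →
      DifferentiableAt ℝ (fun p => G p (f p) (k p)) z := fun hf hk =>
    ((hG.near hz).diff.clm_apply hf).clm_apply hk
  rw [e, e, fderiv_fun_add (hi (hd _ _) (hc _)) (hi (hc _) (hd _ _)),
    fderiv_fun_add (hi (hd _ _) (hc _)) (hi (hc _) (hd _ _))] at hs
  simp only [add_apply, hG.fderiv_inner hz (hd _ _) (hc _), hG.fderiv_inner hz (hc _) (hd _ _),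
    fderiv_fun_const, Pi.zero_apply, zero_apply, zero_add, map_add] at hs
  simp only [curvatureLocal, map_add, map_sub, add_apply, sub_apply]
  linarith

end IsHermitianOn
end Smooth

/-- The curvature of `Γ + A` in terms of the covariant derivative of `A`. -/
theorem curvature_add {E : Type*} [AddCommGroup E] [Module ℝ E] (Γ T A : E →ₗ[ℝ] E →ₗ[ℝ] E)
    (D A' : E →ₗ[ℝ] E →ₗ[ℝ] E →ₗ[ℝ] E) (hT : ∀ u v, T u v = (1 / 2 : ℝ) • (Γ u v - Γ v u))
    (x y v : E) :
    (D x y v + (A' x y v - Γ x (A y v) + A (Γ x y) v + A y (Γ x v)))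
      - (D y x v + (A' y x v - Γ y (A x v) + A (Γ y x) v + A x (Γ y v)))
      + (Γ x (Γ y v + A y v) + A x (Γ y v + A y v)) - (Γ y (Γ x v + A x v) + A y (Γ x v + A x v))
    = (D x y v - D y x v + Γ x (Γ y v) - Γ y (Γ x v)) + A' x y v - A' y x v
      + (2 : ℝ) • A (T x y) v + A x (A y v) - A y (A x v) := by
  simp only [hT, map_add, map_sub, map_smul, LinearMap.sub_apply, LinearMap.smul_apply]
  module

/-! ### The torsion jet of a metric -/

section Jet

variable {E : Type*} [NormedAddCommGroup E] [NormedSpace ℂ E] [FiniteDimensional ℂ E]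
variable {G : E → E →L[ℝ] E →L[ℝ] ℝ} {U : Set E} {z : E}

theorem IsHermitianNear.exists_adjoint (h : IsHermitianNear G z)
    (F : E →ₗ[ℝ] E →ₗ[ℝ] E →ₗ[ℝ] E) :
    ∃ M : E →ₗ[ℝ] E →ₗ[ℝ] E →ₗ[ℝ] E, ∀ x u v w, G z (M x u v) w = G z v (F x u w) := by
  have : FiniteDimensional ℝ E := FiniteDimensional.complexToReal E
  let f : E → E → E → E := fun x u v =>
    raiseIndex (G z) ((G z v).comp (LinearMap.toContinuousLinearMap (F x u)))
  have hf : ∀ x u v w, G z (f x u v) w = G z v (F x u w) := fun x u v w => by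
    rw [raiseIndex_spec h.pos]; rfl
  obtain ⟨M, hM⟩ := exists_trilinear f
    (fun a x x' u v => h.ext fun w => by simp [hf])
    (fun a x u u' v => h.ext fun w => by simp [hf])
    (fun a x u v v' => h.ext fun w => by simp [hf])
  exact ⟨M, fun x u v w => by rw [hM, hf]⟩

/-- This feeds the pointwise algebra with a metric on an open set. The last clause records the one
fact that is not pointwise: traces of the torsion vanishing on all of `U` force those of its
derivative to vanish. -/
theorem IsHermitianOn.exists_torsionJet (hG : IsHermitianOn G U) (hz : z ∈ U) :
    ∃ τ : TorsionJet E, (∀ v, τ.J v = mulI E v) ∧ (∀ u v, τ.T u v = torsion G z u v) ∧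
      (∀ r s x y v, curvatureLocal (canonicalSymbol G r s) z x y v
        = τ.curv ((1 - s) * (1 - r) + s) s x y v) ∧
      ∀ {ι : Type} [Fintype ι] (b : Module.Basis ι ℝ E),
        (∀ y ∈ U, ∀ u, ∑ i, b.repr (torsion G y u (b i)) i = 0) →
        ∀ x u, LinearMap.trace ℝ E (τ.N x u) = 0 := by
  classical
  have : FiniteDimensional ℝ E := FiniteDimensional.complexToReal E
  have h := hG.near hz
  have hn := hG.isOpen.mem_nhds hz
  have hs : ∀ a b, G z a b = G z b a := fun a b => hG.symm z hz a b
  have hdΓ := fun u v => hG.differentiableAt hz (hG.contDiffOn_chernSymbol u v)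
  have hdT := fun u v => hG.differentiableAt hz (hG.contDiffOn_torsion u v)
  have hdS := fun u v => hG.differentiableAt hz (hG.contDiffOn_torsionAdjoint u v)
  obtain ⟨g, hg⟩ := exists_bilinear (fun v w => G z v w) (by simp) (by simp)
  obtain ⟨Γ, hΓ⟩ := exists_bilinear (chernSymbol G z) (fun a u u' v => h.chernSymbol_left a u u' v)
    (fun a u v v' => h.chernSymbol_right a u v v')
  obtain ⟨D, hD⟩ := hG.exists_fderiv_chernSymbol hz
  have hΓJ : ∀ u v, Γ (mulI E u) v = mulI E (Γ u v) := fun u v => by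
    rw [hΓ, hΓ, h.chernSymbol_mulI_left]
  have hΓJ' : ∀ u v, Γ u (mulI E v) = mulI E (Γ u v) := fun u v => by
    rw [hΓ, hΓ, (chern_spec h).2.1]
  have hDJ : ∀ x u v, D x (mulI E u) v = mulI E (D x u v) := fun x u v => by
    rw [hD, hD, ← fderiv_mulI_comp (hdΓ u v)]
    congr 1
    exact Filter.EventuallyEq.fderiv_eq (Filter.eventually_of_mem hn fun y hy =>
      (hG.near hy).chernSymbol_mulI_left u v)
  have hDJ' : ∀ x u v, D x u (mulI E v) = mulI E (D x u v) := fun x u v => by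
    rw [hD, hD, ← fderiv_mulI_comp (hdΓ u v)]
    congr 1
    exact Filter.EventuallyEq.fderiv_eq (Filter.eventually_of_mem hn fun y hy =>
      (chern_spec (hG.near hy)).2.1 u v)
  let T : E →ₗ[ℝ] E →ₗ[ℝ] E := (1 / 2 : ℝ) • (Γ - Γ.flip)
  have hTe : ∀ u v, T u v = (1 / 2 : ℝ) • (Γ u v - Γ v u) := fun u v => rfl
  have hT : ∀ u v, T u v = torsion G z u v := fun u v => by
    rw [hTe, hΓ, hΓ, torsion]
  let dT : E →ₗ[ℝ] E →ₗ[ℝ] E →ₗ[ℝ] E := (1 / 2 : ℝ) • (D - LinearMap.lflip.toLinearMap ∘ₗ D)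
  have hdTe : ∀ x u v, dT x u v = (1 / 2 : ℝ) • (D x u v - D x v u) := fun x u v => rfl
  have hdTD : ∀ x u v, fderiv ℝ (fun y => torsion G y u v) z x = dT x u v := fun x u v => by
    have e : HasFDerivAt (fun y => torsion G y u v) _ z :=
      ((hdΓ u v).hasFDerivAt.sub (hdΓ v u).hasFDerivAt).const_smul (1 / 2 : ℝ)
    rw [e.fderiv, hdTe, hD, hD]
    rfl
  obtain ⟨S, hS⟩ := exists_bilinear (torsionAdjoint G z)
    (fun a u u' v => h.ext fun w => by simp [h.g_torsionAdjoint, ← hT])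
    (fun a u v v' => h.ext fun w => by simp [h.g_torsionAdjoint, ← hT])
  have hST : ∀ u v w, G z (S u v) w = G z v (T u w) := fun u v w => by
    rw [hS, hT, h.g_torsionAdjoint]
  obtain ⟨N, hN⟩ := exists_trilinear
    (fun x u v => dT x u v + Γ x (T u v) - T (Γ x u) v - T u (Γ x v))
    (fun a x x' u v => by
      simp only [map_add, map_smul, LinearMap.add_apply, LinearMap.smul_apply]; module)
    (fun a x x' u v => by
      simp only [map_add, map_smul, LinearMap.add_apply, LinearMap.smul_apply]; module)
    (fun a x x' u v => by
      simp only [map_add, map_smul, LinearMap.add_apply, LinearMap.smul_apply]; module)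
  obtain ⟨M, hM⟩ := h.exists_adjoint N
  obtain ⟨R, hR⟩ := exists_trilinear
    (fun x y v => D x y v - D y x v + Γ x (Γ y v) - Γ y (Γ x v))
    (fun a x x' u v => by
      simp only [map_add, map_smul, LinearMap.add_apply, LinearMap.smul_apply]; module)
    (fun a x x' u v => by
      simp only [map_add, map_smul, LinearMap.add_apply, LinearMap.smul_apply]; module)
    (fun a x x' u v => by
      simp only [map_add, map_smul, LinearMap.add_apply, LinearMap.smul_apply]; module)
  have hRskew : ∀ x y v w, G z (R x y v) w = -G z v (R x y w) := fun x y v w => by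
    have e : ∀ v, R x y v = curvatureLocal (chernSymbol G) z x y v := fun v => by
      rw [hR, curvatureLocal, hD, hD]; simp only [hΓ]
    rw [e, e, hG.chern_curvature_skew hz]
  have hRJ : ∀ x y v, R x y (mulI E v) = mulI E (R x y v) := fun x y v => by
    simp only [hR, hDJ', hΓJ', map_add, map_sub]
  -- `M` was defined as the adjoint of `N`; metricity of the Chern connection identifies it with the
  -- covariant derivative of `S`.
  have hdSM : ∀ x u v, fderiv ℝ (fun y => torsionAdjoint G y u v) z x
      = M x u v - Γ x (S u v) + S (Γ x u) v + S u (Γ x v) := fun x u v => h.ext fun w => by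
    have e : fderiv ℝ (fun y => G y (torsionAdjoint G y u v) w) z x
        = fderiv ℝ (fun y => G y v (torsion G y u w)) z x := by
      congr 1
      exact Filter.EventuallyEq.fderiv_eq (Filter.eventually_of_mem hn fun y hy =>
        (hG.near hy).g_torsionAdjoint u v w)
    have hc : ∀ (u : E), DifferentiableAt ℝ (fun _ : E => u) z := fun u => differentiableAt_const u
    rw [hG.fderiv_inner hz (hdS u v) (hc w), hG.fderiv_inner hz (hc v) (hdT u w)] at e
    simp only [fderiv_fun_const, Pi.zero_apply, zero_apply, zero_add, hdTD, ← hΓ, ← hS, ← hT,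
      map_add, add_apply, hST] at e
    simp only [map_add, map_sub, add_apply, sub_apply, hM, hN, hST]
    linarith
  let τ : TorsionJet E :=
    { J := (mulI E).toLinearMap
      g := g
      T := T
      S := S
      N := N
      M := M
      R := R
      J_J := mulI_mulI
      g_symm := fun v w => by rw [hg, hg, hs]
      g_pos := fun v hv => by rw [hg]; exact hG.pos z hz v hv
      g_J := fun v w => by rw [hg, hg]; exact hG.inv z hz v w
      T_swap := fun u v => by simp only [hTe]; module
      T_J := fun u v => by
        change T (mulI E u) v = mulI E (T u v)
        simp only [hTe, hΓJ, hΓJ', map_smul, map_sub]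
      S_spec := fun u v w => by rw [hg, hg, hST]
      N_swap := fun x u v => by simp only [hN, hTe, hdTe, map_smul, map_sub]; module
      N_J := fun x u v => by
        change N x (mulI E u) v = mulI E (N x u v)
        simp only [hN, hTe, hdTe, hDJ, hDJ', hΓJ, hΓJ', map_smul, map_sub, map_add]
      M_spec := fun x u v w => by rw [hg, hg, hM]
      R_swap := fun x y v => by simp only [hR]; module
      R_J_J := fun x y v => by
        change R (mulI E x) (mulI E y) v = R x y v
        -- The Chern curvature has no (0,2) part, so `R(x,y) - R(Jx,Jy)` is `-J` times curvature
        -- operators commuting with `J`. It is thus self-adjoint as well as skew-adjoint, hence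
        -- zero.
        have e : ∀ v, R x y v - R (mulI E x) (mulI E y) v
            = -mulI E (R (mulI E x) y v + R x (mulI E y) v) := fun v => by
          simp only [hR, hDJ, hΓJ, hΓJ', map_add, map_sub, mulI_mulI]
          module
        refine (sub_eq_zero.1 (h.ext (b := 0) fun w => ?_)).symm
        have e1 : G z (R x y v - R (mulI E x) (mulI E y) v) w
            = -G z v (R x y w - R (mulI E x) (mulI E y) w) := by
          simp only [map_sub, sub_apply, hRskew]; ring
        have e2 : G z (R x y v - R (mulI E x) (mulI E y) v) w
            = G z v (R x y w - R (mulI E x) (mulI E y) w) := by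
          simp only [e, map_neg, map_add, neg_apply, add_apply, h.skew, hRskew, hRJ, neg_neg]
        simp only [map_zero, zero_apply]
        linarith
      R_comp_J := hRJ
      bianchi := fun x y v => by
        simp only [hR, hN, hdTe, hTe, map_smul, map_sub, LinearMap.smul_apply,
          LinearMap.sub_apply]
        module }
  refine ⟨τ, fun v => rfl, hT, fun r s x y v => ?_, fun {ι} _ b hb x u => ?_⟩
  · have e : ∀ x u v, fderiv ℝ (fun p => canonicalSymbol G r s p u v) z x
        = D x u v + (((1 - s) * (1 - r) + s) • ((M x u v - Γ x (S u v) + S (Γ x u) v + S u (Γ x v))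
          - dT x u v) + s • (M x v u - Γ x (S v u) + S (Γ x v) u + S v (Γ x u))) := fun x u v => by
      rw [Filter.EventuallyEq.fderiv_eq (Filter.eventually_of_mem hn fun y hy =>
        (hG.near hy).canonicalSymbol_eq r s u v)]
      have e1 : HasFDerivAt (fun p => chernSymbol G p u v
          + (((1 - s) * (1 - r) + s) • (torsionAdjoint G p u v - torsion G p u v)
            + s • torsionAdjoint G p v u)) _ z :=
        (hdΓ u v).hasFDerivAt.add ((((hdS u v).hasFDerivAt.sub
          (hdT u v).hasFDerivAt).const_smul _).add ((hdS v u).hasFDerivAt.const_smul s))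
      rw [e1.fderiv, ← hdSM, ← hdSM, hD, ← hdTD]
      rfl
    have hN' : ∀ x u v, dT x u v = N x u v - Γ x (T u v) + T (Γ x u) v + T u (Γ x v) :=
      fun x u v => by rw [hN]; module
    let A : E →ₗ[ℝ] E →ₗ[ℝ] E := ((1 - s) * (1 - r) + s) • (S - T) + s • S.flip
    obtain ⟨A', hA'⟩ := exists_trilinear (τ.diffDeriv ((1 - s) * (1 - r) + s) s)
      (fun a x x' u v => by
        simp only [TorsionJet.diffDeriv, map_add, map_smul, LinearMap.add_apply,
          LinearMap.smul_apply]
        module)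
      (fun a x x' u v => by
        simp only [TorsionJet.diffDeriv, map_add, map_smul, LinearMap.add_apply,
          LinearMap.smul_apply]
        module)
      (fun a x x' u v => by
        simp only [TorsionJet.diffDeriv, map_add, map_smul, LinearMap.add_apply,
          LinearMap.smul_apply]
        module)
    have hA : ∀ u v, A u v = τ.diff ((1 - s) * (1 - r) + s) s u v := fun u v => rfl
    have hc : ∀ u v, canonicalSymbol G r s z u v = Γ u v + A u v := fun u v => by
      rw [h.canonicalSymbol_eq, ← hΓ, ← hS, ← hT, ← hS]
      rfl
    have e' : ∀ x u v, fderiv ℝ (fun p => canonicalSymbol G r s p u v) z x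
        = D x u v + (A' x u v - Γ x (A u v) + A (Γ x u) v + A u (Γ x v)) := fun x u v => by
      have hA'' : A' x u v
          = ((1 - s) * (1 - r) + s) • (M x u v - N x u v) + s • M x v u := hA' x u v
      have hAe : ∀ u v, A u v = ((1 - s) * (1 - r) + s) • (S u v - T u v) + s • S v u :=
        fun u v => rfl
      rw [e, hN', hA'', hAe, hAe, hAe, map_add, map_smul, map_smul, map_sub]
      module
    rw [curvatureLocal, e', e']
    simp only [hc]
    rw [curvature_add Γ T A D A' hTe, ← hR, hA', hA', hA, hA, hA, hA, hA]
    rfl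
  · have htr : ∀ f : E →ₗ[ℝ] E, LinearMap.trace ℝ E f = ∑ i, b.repr (f (b i)) i := fun f => by
      rw [LinearMap.trace_eq_matrix_trace ℝ b, Matrix.trace]
      simp [LinearMap.toMatrix_apply]
    have hTt : ∀ u, LinearMap.trace ℝ E (T u) = 0 := fun u => by
      rw [htr]
      simpa only [hT] using hb z hz u
    have hdTt : LinearMap.trace ℝ E (dT x u) = 0 := by
      let c : ι → E →L[ℝ] ℝ := fun i => LinearMap.toContinuousLinearMap (b.coord i)
      have e1 : HasFDerivAt (fun y => ∑ i, c i (torsion G y u (b i))) (∑ i, (c i).comp (fderiv ℝ (fun y => torsion G y u (b i)) z)) z :=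
        HasFDerivAt.fun_sum fun i _ => (c i).hasFDerivAt.comp z (hdT u (b i)).hasFDerivAt
      have e2 : HasFDerivAt (fun y => ∑ i, c i (torsion G y u (b i))) (0 : E →L[ℝ] ℝ) z :=
        (hasFDerivAt_const (0 : ℝ) z).congr_of_eventuallyEq
          (Filter.eventually_of_mem hn fun y hy => hb y hy u)
      have e3 := congrArg (fun f : E →L[ℝ] ℝ => f x) (e1.unique e2)
      simp only [sum_apply, ContinuousLinearMap.comp_apply, hdTD] at e3
      rw [htr]
      exact e3
    -- The connection terms are a commutator and a value of `T`, both of trace zero.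
    have e : N x u = dT x u + (Γ x * T u - T u * Γ x) - T (Γ x u) := by
      ext v
      rw [hN]
      simp only [LinearMap.add_apply, LinearMap.sub_apply, Module.End.mul_apply]
      module
    change LinearMap.trace ℝ E (N x u) = 0
    rw [e, map_sub, map_add, map_sub, LinearMap.trace_mul_comm ℝ (Γ x), hdTt, hTt]
    simp

end Jet

/-! ### The three cases on an open set -/

section KahlerLike

variable {E : Type*} [NormedAddCommGroup E] [NormedSpace ℂ E]
variable {G : E → E →L[ℝ] E →L[ℝ] ℝ} {U : Set E} {z : E} {r s : ℝ}

theorem IsHermitianOn.torsionJet_kahlerLike (hG : IsHermitianOn G U) (hz : z ∈ U)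
    {τ : TorsionJet E} {t : ℝ} (hJ : ∀ v, τ.J v = mulI E v)
    (hc : ∀ x y v, curvatureLocal (canonicalSymbol G r s) z x y v = τ.curv t s x y v)
    (hK : KahlerLikeTensor (curvatureTensor G (canonicalSymbol G r s) z)) :
    τ.KahlerLike t s := by
  have h := hG.near hz
  obtain ⟨h1, h2, h3⟩ := hK
  simp only [curvatureTensor, hc] at h1 h2 h3
  refine ⟨fun x y v => h.ext fun w => ?_, fun x y v => h.ext fun w => ?_,
    fun x y v => h.ext fun w => ?_⟩
  · simp only [map_add, add_apply, map_zero, zero_apply]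
    exact h1 x y v w
  · rw [hJ, hJ]
    exact h2 x y v w
  · have e := h3 x y v (mulI E w)
    rw [hJ, hJ, h.skew, e, mulI_mulI, map_neg, neg_neg]

variable [FiniteDimensional ℂ E]

theorem IsHermitianOn.torsion_eq_zero (hG : IsHermitianOn G U) (hrs : (r, s) ∈ OmegaPrime)
    (hK : ∀ z ∈ U, KahlerLikeTensor (curvatureTensor G (canonicalSymbol G r s) z))
    (hz : z ∈ U) (u v : E) : torsion G z u v = 0 := by
  have : FiniteDimensional ℝ E := FiniteDimensional.complexToReal E
  simp only [OmegaPrime, Omega, Set.mem_sdiff, Set.mem_ofPred_eq, Set.mem_union,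
    Set.mem_insert_iff, Set.mem_singleton_iff, Prod.mk.injEq, not_or, not_and] at hrs
  obtain ⟨h0, hs, h1, h2, h3, h4⟩ := hrs
  have hs1 : s ≠ 1 := fun e => by
    by_cases hr : r = 0
    · exact h1 hr e
    · exact h0 hr e
  obtain ⟨τ, hJ, hT, hc, hN⟩ := hG.exists_torsionJet hz
  have hτ := hG.torsionJet_kahlerLike hz hJ (hc r s) (hK z hz)
  rw [← hT]
  have ht : ∃ t, (1 - s) * (1 - r) + s = t := ⟨_, rfl⟩
  obtain ⟨t, ht⟩ := ht
  rw [ht] at hτ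
  by_cases ht1 : t = 1
  · subst ht1
    refine hτ.T_eq_zero_of_one hs (fun e => ?_) u v
    -- `t = 1` means `(1 - s) r = 0`; then `s = -1` would be the anti-Riemannian point.
    have hr : r = 0 := by
      have e : (1 - s) * r = 0 := by linear_combination -ht
      exact (mul_eq_zero.1 e).resolve_left (sub_ne_zero.2 hs1.symm)
    have e' : (s - 1) * (s + 1) = 0 := by linear_combination e
    rcases mul_eq_zero.1 e' with e' | e'
    · exact hs1 (by linarith)
    · exact h2 hr (by linarith)
  by_cases ht0 : t = 0
  · subst ht0
    -- On `t = 0`, the values `s = 2` and `s = -2` force `r = -1` and `r = 1/3`, the points of `∇⁺`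
    -- and `∇⁻`.
    have hs4 : s ^ 2 ≠ 4 := fun e => by
      have e' : (s - 2) * (s + 2) = 0 := by linear_combination e
      rcases mul_eq_zero.1 e' with e' | e'
      · have : s = 2 := by linarith
        subst this
        exact h3 (by linarith) rfl
      · have : s = -2 := by linarith
        subst this
        exact h4 (by linarith) rfl
    refine hτ.T_eq_zero_of_zero hs hs4 (hN (Module.finBasis ℝ E) fun y hy u => ?_) u v
    -- The derivative of the trace is needed at `z`, so unimodularity is applied to the jet at every
    -- point `y` of `U`.
    obtain ⟨σ, hJ', hT', hc', -⟩ := hG.exists_torsionJet hy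
    have hσ := hG.torsionJet_kahlerLike hy hJ' (hc' r s) (hK y hy)
    rw [ht] at hσ
    have e := hσ.trace_T hs hs4 u
    rw [LinearMap.trace_eq_matrix_trace ℝ (Module.finBasis ℝ E), Matrix.trace] at e
    simpa [LinearMap.toMatrix_apply, hT'] using e
  · exact hτ.T_eq_zero_of_ne hs ht0 ht1 u v

end KahlerLike

/-! ### From the manifold to holomorphic charts -/

section Chart

variable {E : Type*} [NormedAddCommGroup E] [NormedSpace ℂ E]
variable {M : Type*} [TopologicalSpace M] [ChartedSpace E M] [IsManifold 𝓘(ℂ, E) ω M]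

/-- Read in the preferred chart, the inverse of `e` is complex differentiable, so its real
derivative is complex linear. -/
theorem mfderiv_chart_symm_mulI {e : OpenPartialHomeomorph M E} (he : e ∈ atlas E M) {z : E}
    (hz : z ∈ e.target) (v : E) :
    mfderiv 𝓘(ℝ, E) 𝓘(ℝ, E) e.symm z (mulI E v)
      = complexStructure E (e.symm z) (mfderiv 𝓘(ℝ, E) 𝓘(ℝ, E) e.symm z v) := by
  have : IsManifold 𝓘(ℂ, E) 1 M := IsManifold.of_le (n := ω) le_top
  have : IsManifold 𝓘(ℝ, E) 1 M := IsManifold.of_le (n := ω) le_top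
  have hc : MDifferentiableAt 𝓘(ℂ, E) 𝓘(ℂ, E) e.symm z :=
    (mdifferentiable_of_mem_atlas (I := 𝓘(ℂ, E)) he).mdifferentiableAt_symm hz
  have hr : MDifferentiableAt 𝓘(ℝ, E) 𝓘(ℝ, E) e.symm z :=
    (mdifferentiable_of_mem_atlas (I := 𝓘(ℝ, E)) he).mdifferentiableAt_symm hz
  have h1 := hc.differentiableWithinAt_writtenInExtChartAt
  have key : ∀ (F : E → E) (p : E), DifferentiableWithinAt ℂ F Set.univ p →
      fderivWithin ℝ F Set.univ p (mulI E v) = mulI E (fderivWithin ℝ F Set.univ p v) := by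
    intro F p hF
    rw [differentiableWithinAt_univ] at hF
    rw [fderivWithin_univ, (hF.hasFDerivAt.restrictScalars ℝ).fderiv]
    simp [mulI_apply]
  rw [ModelWithCorners.range_eq_univ] at h1
  rw [hr.mfderiv, ModelWithCorners.range_eq_univ]
  exact key _ _ h1

/-- This is the tangent map of the inverse chart composed with the smooth constant field `v`. -/
theorem contMDiffOn_mfderiv_chart_symm {e : OpenPartialHomeomorph M E} (he : e ∈ atlas E M)
    (v : E) :
    ContMDiffOn 𝓘(ℝ, E) (𝓘(ℝ, E).prod 𝓘(ℝ, E)) ∞ (fun z => (Bundle.TotalSpace.mk' E (e.symm z)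
      (mfderiv 𝓘(ℝ, E) 𝓘(ℝ, E) e.symm z v) : TangentBundle 𝓘(ℝ, E) M)) e.target := by
  have : IsManifold 𝓘(ℝ, E) 1 M := IsManifold.of_le (n := ω) le_top
  have h1 : ContMDiffOn 𝓘(ℝ, E) 𝓘(ℝ, E) ω e.symm e.target :=
    contMDiffOn_symm_of_mem_maximalAtlas (IsManifold.subset_maximalAtlas he)
  have h2 := h1.contMDiffOn_tangentMapWithin (m := ∞) le_top
    (e.open_target.uniqueMDiffOn)
  have h3 : ContMDiff 𝓘(ℝ, E) (𝓘(ℝ, E).prod 𝓘(ℝ, E)) ∞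
      (fun z : E => (Bundle.TotalSpace.mk' E z v : TangentBundle 𝓘(ℝ, E) E)) := by
    intro z
    rw [Bundle.contMDiffAt_totalSpace]
    refine ⟨contMDiffAt_id, ?_⟩
    simpa using contMDiffAt_const
  refine (h2.comp h3.contMDiffOn (fun z hz => hz)).congr fun z hz => ?_
  simp only [Function.comp, tangentMapWithin]
  rw [mfderivWithin_of_isOpen e.open_target hz]

theorem HermitianMetric.contDiffOn_inChart [FiniteDimensional ℂ E] (g : HermitianMetric E M)
    {e : OpenPartialHomeomorph M E} (he : e ∈ atlas E M) :
    ContDiffOn ℝ ∞ (g.inChart e) e.target := by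
  have : FiniteDimensional ℝ E := FiniteDimensional.complexToReal E
  have : IsManifold 𝓘(ℝ, E) 1 M := IsManifold.of_le (n := ω) le_top
  have h1 : ContMDiffOn 𝓘(ℝ, E) 𝓘(ℝ, E) ∞ e.symm e.target :=
    (contMDiffOn_symm_of_mem_maximalAtlas (n := ω) (IsManifold.subset_maximalAtlas he)).of_le le_top
  refine contDiffOn_clm_apply.2 fun v => contDiffOn_clm_apply.2 fun w => ?_
  have h2 : ContMDiffOn 𝓘(ℝ, E) (𝓘(ℝ, E).prod 𝓘(ℝ)) ∞
      (fun z ↦ Bundle.TotalSpace.mk' ℝ (E := Bundle.Trivial M ℝ) (e.symm z) (g.inner (e.symm z)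
        (mfderiv 𝓘(ℝ, E) 𝓘(ℝ, E) e.symm z v) (mfderiv 𝓘(ℝ, E) 𝓘(ℝ, E) e.symm z w))) e.target := by
    apply ContMDiffOn.clm_bundle_apply₂ (F₁ := E) (F₂ := E)
    · exact g.contMDiff.comp_contMDiffOn h1
    · exact contMDiffOn_mfderiv_chart_symm he v
    · exact contMDiffOn_mfderiv_chart_symm he w
  intro z hz
  have h3 := (Bundle.contMDiffWithinAt_totalSpace.1 (h2 z hz)).2
  exact h3.contDiffWithinAt

theorem HermitianMetric.inChart_pos (g : HermitianMetric E M)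
    {e : OpenPartialHomeomorph M E} (he : e ∈ atlas E M) {z : E} (hz : z ∈ e.target) (v : E)
    (hv : v ≠ 0) : 0 < g.inChart e z v v := by
  have : IsManifold 𝓘(ℝ, E) 1 M := IsManifold.of_le (n := ω) le_top
  rw [g.inChart_apply]
  refine g.pos _ _ fun h0 => hv ?_
  have hb := (mdifferentiable_of_mem_atlas (I := 𝓘(ℝ, E)) he).symm.mfderiv_bijective hz
  exact hb.injective (h0.trans (map_zero _).symm)

theorem HermitianMetric.inChart_mulI (g : HermitianMetric E M)
    {e : OpenPartialHomeomorph M E} (he : e ∈ atlas E M) {z : E} (hz : z ∈ e.target) (v w : E) :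
    g.inChart e z (mulI E v) (mulI E w) = g.inChart e z v w := by
  have h := g.inner_J (e.symm z) (mfderiv 𝓘(ℝ, E) 𝓘(ℝ, E) e.symm z v)
    (mfderiv 𝓘(ℝ, E) 𝓘(ℝ, E) e.symm z w)
  rw [← mfderiv_chart_symm_mulI he hz, ← mfderiv_chart_symm_mulI he hz] at h
  exact h

theorem HermitianMetric.isHermitianOn_inChart [FiniteDimensional ℂ E] (g : HermitianMetric E M)
    {e : OpenPartialHomeomorph M E} (he : e ∈ atlas E M) :
    IsHermitianOn (g.inChart e) e.target := by
  refine ⟨e.open_target, g.contDiffOn_inChart he, fun z hz v hv => ?_, fun z _ v w => ?_,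
    fun z hz v w => ?_⟩
  · exact g.inChart_pos he hz v hv
  · rw [g.inChart_apply, g.inChart_apply]
    exact g.symm _ _ _
  · exact g.inChart_mulI he hz v w

end Chart
end HermitianGeometry

theorem theorem4 {E : Type*} [NormedAddCommGroup E] [NormedSpace ℂ E] [FiniteDimensional ℂ E]
    {M : Type*} [TopologicalSpace M] [ChartedSpace E M] [IsManifold 𝓘(ℂ, E) ω M]
    (g : HermitianGeometry.HermitianMetric E M) (r s : ℝ)
    (hrs : (r, s) ∈ HermitianGeometry.OmegaPrime)
    (hD : g.IsKahlerLike r s) : g.IsKahler := by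
  intro e he z hz u v w
  have hG := g.isHermitianOn_inChart he
  exact (hG.near hz).dOmega_eq_zero (hG.torsion_eq_zero hrs (hD e he) hz) u v w
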